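/- For $\alpha,\beta>0$ and $z\in\mathbb R$ let $E_{\alpha,\beta}(z)=\sum_{k\ge 0} z^k/\Gamma(\alpha k+\beta)$ and $E_\alpha=E_{\alpha,1}$. Let $\varphi_n(x)=\sqrt{2/\pi}\,\sin(nx)$ and $\lambda_n=n$ for $n\ge 1$, and let $\|\cdot\|$, $\langle\cdot,\cdot\rangle$ be the norm and inner product of real $L^2[0,\pi]$. For $0<\alpha<1$ and $f_0\in L^2[0,\pi]$ put $$u_\alpha(\cdot,t)=\sum_{n\ge 1}E_\alpha(-\lambda_n^2t^\alpha)\langle f_0,\varphi_n\rangle\varphi_n\quad(t\ge 0).$$ For $\tau>0$ and $\rho\ge 0$ put $$K_\alpha u=\sum_{n\ge1}E_\alpha(-\lambda_n^2\tau^\alpha)\langle u,\varphi_n\rangle\varphi_n,\qquad \mathcal M_{\alpha,\rho}=\{K_\alpha u: u\in L^2[0,\pi],\ \|u\|\le\rho\}.$$ An index function is a continuous, strictly increasing function $\varphi:(0,\infty)\to[0,\infty)$ with $\varphi(t)\to0$ as $t\to0^+$. (a) There is an absolute constant $C>0$ such that, for all $\alpha\in(0,1)$, $$|E_{\alpha,\alpha+1}(-x)|\le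 \frac{C}{1+x}\quad\text{for all }x>0, \tag{1}$$ and for all $0<\alpha_0<\alpha_1<1$ there is $C_2>0$ such that, for all $\alpha\in[\alpha_0,\alpha_1]$, $$E_\alpha(-x)\le\frac{C_2}{\Gamma(1-\alpha)(1+x)}\quad\text{for all }x>0. \tag{2}$$ (b) For all $\alpha\in(0,1)$ and $f_0\in L^2[0,\pi]$, $u_\alpha$ is the unique weak solution of the time-fractional heat problem $\partial^\alpha u/\partial t^\alpha=\partial^2u/\partial x^2$ $(0<x<\pi,\ t>0)$, $u(0,t)=u(\pi,t)=0$, $u(\cdot,0)=f_0$, with the Caputo derivative in time; that is, the unique $u\in C([0,\infty);L^2[0,\pi])$ with $u(0)=f_0$ such that for every $w\in C^2$ with $w(0)=w(\pi)=0$ the function $y(t)=\int_0^\pi u(x,t)w(x)\,dx$ is differentiable on $(0,\infty)$, and for every $t>0$ the function $s\mapsto y'(s)(t-s)^{-\alpha}$ is integrable on $(0,t)$ and $$\frac1{\Gamma(1-\alpha)}\int_0^t\frac{y'(s)}{(t-s)^\alpha}\,ds=\int_0^\pi u(x,t)w''(x)\,dx .$$ (c) Let $0<\alpha<1$, $\tau>0$,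 $\rho\ge0$, let $C,C_2>0$ be any constants for which (1) and (2) hold for this $\alpha$, and put $C_\alpha=C\,C_2/\Gamma(1-\alpha)$. If $f_0\in\mathcal M_{\alpha,\rho}$, then $$\|u_\alpha(\cdot,t)-f_0\|\le\rho\,C_\alpha\,\frac{t^\alpha}{\tau^\alpha}\quad\text{for all }t\ge0 .$$ Thus $\varphi(t)=t^\alpha$ is an index function that satisfies the source-type assumption: there is $c_0>0$ with $\|u_\alpha(\cdot,t)-f_0\|\le c_0\,\varphi(t)$ for all $t>0$. -/

import Mathlib

noncomputable section

namespace FracHeat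

open MeasureTheory

/-- The generalized Mittag-Leffler function `E_{α,β}(z) = ∑_{k ≥ 0} z ^ k / Γ(α k + β)`
(at real arguments, the only ones used; the series converges for all `α, β > 0`). -/
def mittagLeffler₂ (α β z : ℝ) : ℝ :=
  ∑' k : ℕ, z ^ k / Real.Gamma (α * k + β)

/-- The Mittag-Leffler function `E_α(z) = ∑_{k ≥ 0} z ^ k / Γ(k α + 1)`. -/
def mittagLeffler (α z : ℝ) : ℝ :=
  ∑' k : ℕ, z ^ k / Real.Gamma (k * α + 1)

/-- Lebesgue measure on the interval `[0, π]`. -/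
abbrev rodMeasure : Measure ℝ := volume.restrict (Set.Icc 0 Real.pi)

/-- The real Hilbert space `L²[0, π]`. -/
abbrev L2Rod : Type := Lp ℝ 2 rodMeasure

theorem memLp_sine (n : ℕ) :
    MemLp (fun x : ℝ => Real.sqrt (2 / Real.pi) * Real.sin ((n + 1 : ℝ) * x)) 2 rodMeasure := by
  refine MemLp.of_bound (by fun_prop) (Real.sqrt (2 / Real.pi)) (Filter.Eventually.of_forall ?_)
  intro x
  rw [norm_mul, Real.norm_of_nonneg (Real.sqrt_nonneg _)]
  exact mul_le_of_le_one_right (Real.sqrt_nonneg _) (Real.abs_sin_le_one _)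

/-- The normalized Dirichlet eigenfunctions `√(2/π) sin (m x)`, `m = n + 1 ≥ 1`,
as elements of `L²[0, π]`. -/
def sineBasis (n : ℕ) : L2Rod := (memLp_sine n).toLp _

/-- The frequencies `λ_m = m`, `m = n + 1 ≥ 1`. -/
def freq (n : ℕ) : ℝ := n + 1

/-- The function `u_α(·, t) = ∑_m E_α(-λ_m² t ^ α) ⟨f₀, φ_m⟩ φ_m` in `L²[0, π]`. -/
def fracHeatSol (α : ℝ) (f₀ : L2Rod) (t : ℝ) : L2Rod :=
  ∑' n : ℕ, (mittagLeffler α (-(freq n) ^ 2 * t ^ α) * inner ℝ f₀ (sineBasis n)) • sineBasis n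

/-- The operator `K_α u = ∑_m E_α(-λ_m² τ ^ α) ⟨u, φ_m⟩ φ_m` on `L²[0, π]`. -/
def sourceOp (α τ : ℝ) (u : L2Rod) : L2Rod :=
  ∑' n : ℕ, (mittagLeffler α (-(freq n) ^ 2 * τ ^ α) * inner ℝ u (sineBasis n)) • sineBasis n

/-- The source set `{K_α u : ‖u‖ ≤ ρ}`. -/
def sourceSet (α τ ρ : ℝ) : Set L2Rod :=
  {f | ∃ u : L2Rod, ‖u‖ ≤ ρ ∧ sourceOp α τ u = f}

/-- The Caputo derivative `1/Γ(1-α) ∫₀ᵗ y'(s) / (t-s) ^ α ds` of `y` exists at every `t > 0`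
and equals `g t`. -/
def HasCaputoDerivOn (α : ℝ) (y g : ℝ → ℝ) : Prop :=
  ∀ t : ℝ, 0 < t →
    DifferentiableAt ℝ y t ∧
    IntervalIntegrable (fun s => deriv y s / (t - s) ^ α) volume 0 t ∧
    1 / Real.Gamma (1 - α) * ∫ s in (0 : ℝ)..t, deriv y s / (t - s) ^ α = g t

/-- Weak solutions `u ∈ C([0,∞); L²[0, π])` of `∂ᵅu/∂tᵅ = u_xx` on `0 < x < π`, `t > 0`, with
`u(0, t) = u(π, t) = 0` and `u(·, 0) = f₀`. The differential equation and the boundary values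
are imposed by testing with all `C²` functions that vanish at `0` and `π` and moving both
space derivatives to the test function: a smooth `u` that satisfies these identities solves
the equation and vanishes at both ends. -/
structure IsWeakSolution (α : ℝ) (f₀ : L2Rod) (u : ℝ → L2Rod) : Prop where
  initial : u 0 = f₀
  continuousOn : ContinuousOn u (Set.Ici 0)
  equation : ∀ w : ℝ → ℝ, ContDiff ℝ 2 w → w 0 = 0 → w Real.pi = 0 →
    HasCaputoDerivOn α (fun t => ∫ x, u t x * w x ∂rodMeasure)
      (fun t => ∫ x, u t x * deriv (deriv w) x ∂rodMeasure)

/-- `C₂` is a constant in the upper bound `E_α(-x) ≤ C₂ / (Γ(1-α) (1+x))`, `x > 0`. -/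
def IsUpperConst (α C₂ : ℝ) : Prop :=
  ∀ x : ℝ, 0 < x → mittagLeffler α (-x) ≤ C₂ / (Real.Gamma (1 - α) * (1 + x))

/-- `C` is a constant in the bound `|E_{α,α+1}(-x)| ≤ C / (1+x)`, `x > 0`. -/
def IsGenConst (α C : ℝ) : Prop :=
  ∀ x : ℝ, 0 < x → |mittagLeffler₂ α (α + 1) (-x)| ≤ C / (1 + x)

/-- Index functions `(0,∞) → [0,∞)`: continuous, strictly increasing, with limit `0` at `0`. -/
structure IsIndexFunction (φ : ℝ → ℝ) : Prop where
  nonneg : ∀ t, 0 < t → 0 ≤ φ t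
  continuousOn : ContinuousOn φ (Set.Ioi 0)
  strictMonoOn : StrictMonoOn φ (Set.Ioi 0)
  tendsto_zero : Filter.Tendsto φ (nhdsWithin 0 (Set.Ioi 0)) (nhds 0)

/-- The index function `φ` satisfies the source-type assumption for the curve `u` in
`L²[0, π]` and the initial value `f₀`: `‖u(·, t) - f₀‖ ≤ c₀ φ(t)` for some `c₀ > 0`. -/
def SatisfiesSourceAssumption (u : ℝ → L2Rod) (f₀ : L2Rod) (φ : ℝ → ℝ) : Prop :=
  IsIndexFunction φ ∧ ∃ c₀ : ℝ, 0 < c₀ ∧ ∀ t : ℝ, 0 < t → ‖u t - f₀‖ ≤ c₀ * φ t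

end FracHeat

end

noncomputable section

namespace FracHeat

open MeasureTheory Set Filter Topology

/-! Everything rests on the scalar relaxation functions `mlPow α γ lam t`, which fractional
integration of order `b` carries from `γ` to `γ + b` (`integral_mlPow`, the Beta integral applied
termwise). Write `e` for the function with `γ = 1`, that is `E_α(-lam t ^ α)`, and `k` for the one
with `γ = α`. Then `e' = -lam k`, and `e` is the fractional integral of order `1 - α` of `k`. Hence
the Caputo derivative of `e` is `-lam e`.

The decisive fact is `k > 0` (`mlPow_self_pos`), proved from a Volterra equation by excluding a
first zero. It makes `e` decreasing with values in `[0, 1]`. Inserting this in the integral equation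
for `e` gives `E_α(-x) ≤ 1 / (1 + x)` and `0 ≤ 1 - E_α(-x) ≤ x / Γ(α + 1)`. Both bounds of (a)
follow, the one for `E_{α,α+1}` through `1 - E_α(-x) = x E_{α,α+1}(-x)`.

The sines form a Hilbert basis, so the problem decouples. Existence is termwise Caputo
differentiation, controlled by the summability of `⟨f₀, φ_n⟩⟨φ_n, w''⟩`. For uniqueness, testing
with a sine and inverting the Caputo derivative turns each coefficient into the solution of a scalar
Volterra equation, which has only one.

For the estimate, each coefficient of `u_α(t) - f₀` is that of the source element `u` times
`(E_α(-λ² t ^ α) - 1) E_α(-λ² τ ^ α)`. The first factor is at most `C λ² t ^ α`, the second at most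
`C₂ / (Γ(1 - α) λ² τ ^ α)`. The eigenvalue cancels, and Parseval concludes. -/

theorem mittagLeffler_eq (α z : ℝ) : mittagLeffler α z = mittagLeffler₂ α 1 z := by
  simp only [mittagLeffler, mittagLeffler₂, mul_comm]

/-! ### Convergence, continuity and recurrence of the Mittag-Leffler series. -/

/-- Cut the Gamma integral down to `(R, ∞)`, where the power is at least `R ^ (s - 1)`. As `R` is
free, `Γ` outgrows every geometric sequence. -/
theorem rpow_mul_exp_le_Gamma {R s : ℝ} (hR : 0 ≤ R) (hs : 1 ≤ s) :
    R ^ (s - 1) * Real.exp (-R) ≤ Real.Gamma s := by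
  have hint := Real.GammaIntegral_convergent (s := s) (by linarith)
  have hsub : Ioi R ⊆ Ioi (0 : ℝ) := Ioi_subset_Ioi hR
  rw [Real.Gamma_eq_integral (by linarith), ← integral_exp_neg_Ioi, ← integral_const_mul]
  calc ∫ x in Ioi R, R ^ (s - 1) * Real.exp (-x)
      ≤ ∫ x in Ioi R, Real.exp (-x) * x ^ (s - 1) := by
        refine setIntegral_mono_on ?_ (hint.mono_set hsub) measurableSet_Ioi fun x hx => ?_
        · exact (integrableOn_exp_neg_Ioi R).const_mul _
        · rw [mul_comm]
          exact mul_le_mul_of_nonneg_left (Real.rpow_le_rpow hR (le_of_lt hx) (by linarith))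
            (Real.exp_pos _).le
    _ ≤ _ := by
        refine setIntegral_mono_set hint ?_ (Eventually.of_forall hsub)
        filter_upwards [self_mem_ae_restrict measurableSet_Ioi] with x hx
        have : (0 : ℝ) < x := hx
        simp only [Pi.zero_apply]
        positivity

/-- Absolute convergence of the Mittag-Leffler series, by comparison with a geometric series. -/
theorem summable_pow_div_Gamma {α : ℝ} (hα : 0 < α) (β z : ℝ) :
    Summable fun k : ℕ => |z| ^ k / |Real.Gamma (α * k + β)| := by
  -- With this `R`, `|z| ^ k ≤ 2⁻ᵏ R ^ (α k)`, and the power of `R` is absorbed by the Gamma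
  -- function.
  obtain ⟨R, hR1, hR⟩ : ∃ R : ℝ, 0 < R ∧ 2 * |z| ≤ R ^ α := by
    have h := (tendsto_rpow_atTop hα).eventually_ge_atTop (2 * |z|)
    obtain ⟨R, h1, h2⟩ := ((eventually_gt_atTop 0).and h).exists
    exact ⟨R, h1, h2⟩
  have hlarge : ∀ᶠ k : ℕ in atTop, 1 ≤ α * k + β :=
    (tendsto_atTop_add_const_right _ β
      (tendsto_natCast_atTop_atTop.const_mul_atTop hα)).eventually_ge_atTop 1
  refine Summable.of_norm_bounded_eventually_nat
    (g := fun k : ℕ => Real.exp R * R ^ (1 - β) * (1 / 2 : ℝ) ^ k)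
    (summable_geometric_two.mul_left _) ?_
  filter_upwards [hlarge] with k hk
  have h := rpow_mul_exp_le_Gamma hR1.le hk
  have hpos : 0 < R ^ (α * k + β - 1) * Real.exp (-R) := by positivity
  rw [Real.norm_of_nonneg (by positivity), abs_of_pos (hpos.trans_le h),
    div_le_iff₀ (hpos.trans_le h)]
  have h2 : |z| ^ k ≤ (1 / 2) ^ k * R ^ (α * k) := by
    rw [Real.rpow_mul hR1.le, Real.rpow_natCast, ← mul_pow]
    gcongr
    linarith
  refine h2.trans ?_
  have h3 : Real.exp R * R ^ (1 - β) * (1 / 2) ^ k * (R ^ (α * k + β - 1) * Real.exp (-R)) =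
      (1 / 2) ^ k * R ^ (α * k) := by
    have e1 : R ^ (1 - β) * R ^ (α * k + β - 1) = R ^ (α * k) := by
      rw [← Real.rpow_add hR1]; ring_nf
    have e2 : Real.exp R * Real.exp (-R) = 1 := by rw [← Real.exp_add]; simp
    calc _ = (Real.exp R * Real.exp (-R)) * (1 / 2) ^ k * (R ^ (1 - β) * R ^ (α * k + β - 1)) := by
          ring
      _ = _ := by rw [e1, e2]; ring
  rw [← h3]
  gcongr

theorem summable_mittagLeffler₂ {α : ℝ} (hα : 0 < α) (β z : ℝ) :
    Summable fun k : ℕ => z ^ k / Real.Gamma (α * k + β) :=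
  .of_norm (by simpa [abs_div, abs_pow] using summable_pow_div_Gamma hα β z)

theorem continuous_mittagLeffler₂ {α : ℝ} (hα : 0 < α) (β : ℝ) :
    Continuous (mittagLeffler₂ α β) := by
  rw [continuous_iff_continuousAt]
  intro z
  have h : ContinuousOn (mittagLeffler₂ α β) (Icc (z - 1) (z + 1)) := by
    refine continuousOn_tsum (fun k => by fun_prop) (summable_pow_div_Gamma hα β (|z| + 1)) ?_
    intro k x hx
    rw [norm_div, norm_pow, Real.norm_eq_abs, Real.norm_eq_abs]
    have : |x| ≤ |(|z| + 1)| := by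
      rw [abs_of_nonneg (by positivity : 0 ≤ |z| + 1), abs_le]
      constructor <;> linarith [hx.1, hx.2, le_abs_self z, neg_abs_le z]
    gcongr
  exact h.continuousAt (Icc_mem_nhds (by linarith) (by linarith))

theorem mittagLeffler₂_zero (α β : ℝ) : mittagLeffler₂ α β 0 = 1 / Real.Gamma β := by
  rw [mittagLeffler₂, tsum_eq_single 0]
  · simp
  · intro k hk
    simp [hk]

/-- The recurrence `E_{α,β}(z) = 1/Γ(β) + z E_{α,α+β}(z)`. -/
theorem mittagLeffler₂_recurrence {α : ℝ} (hα : 0 < α) (β z : ℝ) :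
    mittagLeffler₂ α β z = 1 / Real.Gamma β + z * mittagLeffler₂ α (α + β) z := by
  rw [mittagLeffler₂, (summable_mittagLeffler₂ hα β z).tsum_eq_zero_add, mittagLeffler₂,
    ← tsum_mul_left]
  congr 1
  · simp
  · refine tsum_congr fun k => ?_
    push_cast
    rw [pow_succ', mul_div_assoc]
    ring_nf

/-! ### Beta integrals and fractional integration of relaxation functions. -/

theorem integral_rpow_mul_rpow {a b t : ℝ} (ha : 0 < a) (hb : 0 < b) (ht : 0 < t) :
    ∫ s in (0 : ℝ)..t, (t - s) ^ (b - 1) * s ^ (a - 1) =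
      Real.Gamma b * (t ^ (a + b - 1) * Real.Gamma a / Real.Gamma (a + b)) := by
  have h := Complex.betaIntegral_scaled a b ht
  have hG := Complex.Gamma_mul_Gamma_eq_betaIntegral (s := a) (t := b) (by simpa) (by simpa)
  rw [← Complex.ofReal_inj, ← intervalIntegral.integral_ofReal]
  have hne : Complex.Gamma ((a : ℂ) + b) ≠ 0 := by
    rw [← Complex.ofReal_add, Complex.Gamma_ofReal]
    exact_mod_cast (Real.Gamma_pos_of_pos (by linarith)).ne'
  have e : Complex.betaIntegral a b = Complex.Gamma a * Complex.Gamma b / Complex.Gamma (a + b) := by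
    rw [eq_div_iff hne, hG]; ring
  have hpow : (t : ℂ) ^ ((a : ℂ) + b - 1) = ((t ^ (a + b - 1) : ℝ) : ℂ) := by
    rw [Complex.ofReal_cpow ht.le]; push_cast; rfl
  rw [hpow, e, ← Complex.ofReal_add, Complex.Gamma_ofReal, Complex.Gamma_ofReal,
    Complex.Gamma_ofReal] at h
  rw [show ((Real.Gamma b * (t ^ (a + b - 1) * Real.Gamma a / Real.Gamma (a + b)) : ℝ) : ℂ) =
    ((t ^ (a + b - 1) : ℝ) : ℂ) *
      ((Real.Gamma a : ℂ) * (Real.Gamma b : ℂ) / (Real.Gamma (a + b) : ℂ)) by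
        push_cast; ring, ← h]
  refine intervalIntegral.integral_congr fun s hs => ?_
  rw [uIcc_of_le ht.le] at hs
  simp only [Complex.ofReal_mul]
  rw [Complex.ofReal_cpow (by linarith [hs.2]), Complex.ofReal_cpow hs.1]
  push_cast
  ring

/-- The integral of a non-integrable function is 0 by convention, so the nonzero Beta value proves
integrability. -/
theorem intervalIntegrable_rpow_mul_rpow {a b t : ℝ} (ha : 0 < a) (hb : 0 < b) (ht : 0 < t) :
    IntervalIntegrable (fun s => (t - s) ^ (b - 1) * s ^ (a - 1)) volume 0 t := by
  refine intervalIntegral.intervalIntegrable_of_integral_ne_zero ?_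
  rw [integral_rpow_mul_rpow ha hb ht]
  have := Real.Gamma_pos_of_pos ha
  have := Real.Gamma_pos_of_pos hb
  have := Real.Gamma_pos_of_pos (add_pos ha hb)
  positivity

/-- The function `t ^ (γ - 1) E_{α,γ}(-lam t ^ α)`. -/
def mlPow (α γ lam t : ℝ) : ℝ := t ^ (γ - 1) * mittagLeffler₂ α γ (-lam * t ^ α)

theorem intervalIntegrable_mlPow {α γ b t : ℝ} (hα : 0 < α) (hγ : 0 < γ) (hb : 0 < b) (ht : 0 < t)
    (lam : ℝ) :
    IntervalIntegrable (fun s => (t - s) ^ (b - 1) * mlPow α γ lam s) volume 0 t := by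
  have h := (intervalIntegrable_rpow_mul_rpow hγ hb ht).mul_continuousOn
    (g := fun s => mittagLeffler₂ α γ (-lam * s ^ α)) (by
      refine ((continuous_mittagLeffler₂ hα γ).comp ?_).continuousOn
      exact continuous_const.mul (Real.continuous_rpow_const hα.le))
  simpa only [mlPow, mul_assoc] using h

/-- Fractional integration of order `b` raises the parameter `γ` by `b`. -/
theorem integral_mlPow {α γ b t : ℝ} (hα : 0 < α) (hγ : 0 < γ) (hb : 0 < b) (ht : 0 < t)
    (lam : ℝ) :
    ∫ s in (0 : ℝ)..t, (t - s) ^ (b - 1) * mlPow α γ lam s =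
      Real.Gamma b * mlPow α (γ + b) lam t := by
  have hak : ∀ k : ℕ, 0 < α * k + γ := fun k => by positivity
  have hF : ∀ k : ℕ, ∀ s ∈ Ioc 0 t, (t - s) ^ (b - 1) * s ^ (γ - 1) *
      ((-lam * s ^ α) ^ k / Real.Gamma (α * k + γ)) =
      (-lam) ^ k / Real.Gamma (α * k + γ) * ((t - s) ^ (b - 1) * s ^ (α * k + γ - 1)) := by
    intro k s hs
    have : s ^ (α * k + γ - 1) = s ^ (γ - 1) * (s ^ α) ^ k := by
      rw [← Real.rpow_natCast, ← Real.rpow_mul hs.1.le, ← Real.rpow_add hs.1]; ring_nf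
    rw [this, mul_pow]; ring
  have hI : ∀ k : ℕ, IntegrableOn (fun s => (-lam) ^ k / Real.Gamma (α * k + γ) *
      ((t - s) ^ (b - 1) * s ^ (α * k + γ - 1))) (Ioc 0 t) := fun k =>
    (intervalIntegrable_iff_integrableOn_Ioc_of_le ht.le).1
      ((intervalIntegrable_rpow_mul_rpow (hak k) hb ht).const_mul _)
  have hval : ∀ k : ℕ, ∫ s in Ioc 0 t, (t - s) ^ (b - 1) * s ^ (α * k + γ - 1) =
      Real.Gamma b * (t ^ (α * k + γ + b - 1) * Real.Gamma (α * k + γ) /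
        Real.Gamma (α * k + γ + b)) := fun k => by
    rw [← intervalIntegral.integral_of_le ht.le, integral_rpow_mul_rpow (hak k) hb ht]
  have hpow : ∀ k : ℕ, t ^ (α * k + γ + b - 1) = t ^ (γ + b - 1) * (t ^ α) ^ k := fun k => by
    rw [← Real.rpow_natCast, ← Real.rpow_mul ht.le, ← Real.rpow_add ht]; ring_nf
  -- The integrals of the absolute values are, up to a common factor, the terms of the absolutely
  -- convergent series for `E_{α,γ+b}`; this licenses exchanging sum and integral.
  have hsum : Summable fun k : ℕ => ∫ s in Ioc 0 t, ‖(-lam) ^ k / Real.Gamma (α * k + γ) *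
      ((t - s) ^ (b - 1) * s ^ (α * k + γ - 1))‖ := by
    have h := (summable_pow_div_Gamma hα (γ + b) (-lam * t ^ α)).mul_left
      (Real.Gamma b * t ^ (γ + b - 1))
    refine h.congr fun k => ?_
    have e : ∀ s ∈ Ioc 0 t, ‖(-lam) ^ k / Real.Gamma (α * k + γ) *
      ((t - s) ^ (b - 1) * s ^ (α * k + γ - 1))‖ = |(-lam)| ^ k / Real.Gamma (α * k + γ) *
      ((t - s) ^ (b - 1) * s ^ (α * k + γ - 1)) := by
      intro s hs
      have h1 : 0 ≤ (t - s) ^ (b - 1) := Real.rpow_nonneg (by linarith [hs.2]) _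
      have h2 : 0 ≤ s ^ (α * k + γ - 1) := Real.rpow_nonneg hs.1.le _
      rw [norm_mul, norm_div, norm_pow, Real.norm_eq_abs, Real.norm_eq_abs, Real.norm_eq_abs,
        abs_of_nonneg (mul_nonneg h1 h2), abs_of_pos (Real.Gamma_pos_of_pos (hak k))]
    rw [setIntegral_congr_fun measurableSet_Ioc e, integral_const_mul, hval, hpow,
      abs_of_pos (Real.Gamma_pos_of_pos (by positivity)), abs_mul, mul_pow,
      abs_of_pos (Real.rpow_pos_of_pos ht α), add_assoc]
    have := (Real.Gamma_pos_of_pos (hak k)).ne'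
    field_simp
  have key := hasSum_integral_of_summable_integral_norm hI hsum
  rw [intervalIntegral.integral_of_le ht.le]
  have e1 : ∫ s in Ioc 0 t, (t - s) ^ (b - 1) * mlPow α γ lam s =
      ∫ s in Ioc 0 t, ∑' k : ℕ, (-lam) ^ k / Real.Gamma (α * k + γ) *
      ((t - s) ^ (b - 1) * s ^ (α * k + γ - 1)) := by
    refine setIntegral_congr_fun measurableSet_Ioc fun s hs => ?_
    simp only [mlPow, mittagLeffler₂]
    rw [← mul_assoc, ← tsum_mul_left]
    exact tsum_congr fun k => hF k s hs
  rw [e1, ← key.tsum_eq, mlPow, mittagLeffler₂, ← mul_assoc, ← tsum_mul_left]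
  refine tsum_congr fun k => ?_
  rw [integral_const_mul, hval, hpow, mul_pow, ← add_assoc]
  have := (Real.Gamma_pos_of_pos (hak k)).ne'
  field_simp

theorem continuousOn_mlPow {α : ℝ} (hα : 0 < α) (γ lam : ℝ) :
    ContinuousOn (mlPow α γ lam) (Ioi 0) := by
  refine ContinuousOn.mul (fun x hx => ?_) ?_
  · exact (Real.continuousAt_rpow_const x _ (Or.inl (ne_of_gt hx))).continuousWithinAt
  · refine ((continuous_mittagLeffler₂ hα γ).comp ?_).continuousOn
    exact continuous_const.mul (Real.continuous_rpow_const hα.le)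

theorem mlPow_one_right (α lam t : ℝ) : mlPow α 1 lam t = mittagLeffler α (-lam * t ^ α) := by
  simp [mlPow, mittagLeffler_eq]

theorem mlPow_recurrence {α γ t : ℝ} (hα : 0 < α) (ht : 0 < t) (lam : ℝ) :
    mlPow α γ lam t = t ^ (γ - 1) / Real.Gamma γ - lam * mlPow α (γ + α) lam t := by
  rw [mlPow, mittagLeffler₂_recurrence hα, mlPow, add_comm α γ,
    show γ + α - 1 = (γ - 1) + α by ring, Real.rpow_add ht]
  ring

/-! ### Positivity of the relaxation kernel. -/

theorem integral_sub_rpow {a t T : ℝ} (ha : 0 < a) :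
    ∫ s in t..T, (T - s) ^ (a - 1) = (T - t) ^ a / a := by
  rw [intervalIntegral.integral_comp_sub_left (fun s => s ^ (a - 1)) T,
    integral_rpow (Or.inl (by linarith))]
  simp [Real.zero_rpow ha.ne']

theorem intervalIntegrable_sub_rpow {a t T : ℝ} (ha : 0 < a) :
    IntervalIntegrable (fun s => (T - s) ^ (a - 1)) volume t T := by
  have h := (intervalIntegral.intervalIntegrable_rpow' (a := T - t) (b := 0)
    (show -1 < a - 1 by linarith)).comp_sub_left T
  simpa using h

/-- The recurrence at `γ = α`, with its remainder of parameter `2α` rewritten as the fractional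
integral of order `α` of the kernel. -/
theorem mlPow_volterra {α t : ℝ} (hα : 0 < α) (ht : 0 < t) (lam : ℝ) :
    t ^ (α - 1) = Real.Gamma α * mlPow α α lam t +
      lam * ∫ s in (0 : ℝ)..t, (t - s) ^ (α - 1) * mlPow α α lam s := by
  have hG := (Real.Gamma_pos_of_pos hα).ne'
  rw [integral_mlPow hα hα hα ht, mlPow_recurrence (γ := α) hα ht]
  field_simp
  ring

/-- Near 0 the sign is that of `E_{α,α}(0) = 1/Γ(α)`. -/
theorem mlPow_self_pos_near_zero {α : ℝ} (hα : 0 < α) (lam : ℝ) :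
    ∃ ε > 0, ∀ t ∈ Ioo 0 ε, 0 < mlPow α α lam t := by
  have hc : Continuous fun t : ℝ => mittagLeffler₂ α α (-lam * t ^ α) :=
    (continuous_mittagLeffler₂ hα α).comp
      (continuous_const.mul (Real.continuous_rpow_const hα.le))
  have h0 : 0 < mittagLeffler₂ α α (-lam * (0 : ℝ) ^ α) := by
    rw [Real.zero_rpow hα.ne', mul_zero, mittagLeffler₂_zero]
    exact one_div_pos.2 (Real.Gamma_pos_of_pos hα)
  obtain ⟨ε, hε, h⟩ := Metric.eventually_nhds_iff.1 (hc.continuousAt.eventually (lt_mem_nhds h0))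
  refine ⟨ε, hε, fun t ht => mul_pos (Real.rpow_pos_of_pos ht.1 _) (h ?_)⟩
  rw [Real.dist_eq, sub_zero, abs_of_pos ht.1]
  exact ht.2

/-- The relaxation kernel cannot reach zero: the log-convexity of the power kernel in the
Volterra equation excludes a first zero `T`. -/
theorem not_mlPow_self_nonpos {α lam T : ℝ} (hα : 0 < α) (hα1 : α < 1) (hlam : 0 ≤ lam)
    (hT : 0 < T) (hpos : ∀ t ∈ Ioo 0 T, 0 < mlPow α α lam t) : ¬ mlPow α α lam T ≤ 0 := by
  intro hk
  have hG := Real.Gamma_pos_of_pos hα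
  -- On a window of length `η` before `T` the Volterra integral is too weak to consume half of `Γ(α)
  -- k`.
  obtain ⟨η, hη0, hηT, hη⟩ : ∃ η : ℝ, 0 < η ∧ η ≤ T / 2 ∧ lam * (η ^ α / α) < Real.Gamma α / 2 := by
    have hc : ContinuousAt (fun η : ℝ => lam * (η ^ α / α)) 0 :=
      (continuous_const.mul ((Real.continuous_rpow_const hα.le).div_const _)).continuousAt
    have h0 : (fun η : ℝ => lam * (η ^ α / α)) 0 < Real.Gamma α / 2 := by
      simp only [Real.zero_rpow hα.ne', zero_div, mul_zero]; positivity
    have h1 : ∀ᶠ η : ℝ in 𝓝[>] 0, lam * (η ^ α / α) < Real.Gamma α / 2 :=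
      nhdsWithin_le_nhds (hc.eventually (gt_mem_nhds h0))
    have h2 : ∀ᶠ η : ℝ in 𝓝[>] 0, η ≤ T / 2 :=
      nhdsWithin_le_nhds (eventually_le_nhds (by positivity))
    obtain ⟨η, h3, h4, h5⟩ := (h1.and (h2.and self_mem_nhdsWithin)).exists
    exact ⟨η, h5, h4, h3⟩
  set k := mlPow α α lam with hkdef
  -- The equation at `T` is compared with the one at a maximum point `t` of `k` on the window.
  obtain ⟨t, htI, htmax⟩ := isCompact_Icc.exists_isMaxOn (s := Icc (T - η) T) (f := k)
    ⟨T, by constructor <;> linarith⟩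
    ((continuousOn_mlPow hα α lam).mono fun x hx => by
      have := hx.1
      show 0 < x
      linarith)
  have hmid : 0 < k t := (hpos (T - η) ⟨by linarith, by linarith⟩).trans_le
    (htmax ⟨le_rfl, by linarith⟩)
  have htT : t < T := lt_of_le_of_ne htI.2 fun h => absurd hk (not_le.2 (h ▸ hmid))
  have ht0 : 0 < t := by linarith [htI.1]
  have hint : IntervalIntegrable (fun s => (T - s) ^ (α - 1) * k s) volume 0 T :=
    intervalIntegrable_mlPow hα hα hα hT lam
  have hintL : IntervalIntegrable (fun s => (T - s) ^ (α - 1) * k s) volume 0 t :=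
    hint.mono_set (by rw [uIcc_of_le hT.le, uIcc_of_le ht0.le]; exact Icc_subset_Icc_right htT.le)
  have hintR : IntervalIntegrable (fun s => (T - s) ^ (α - 1) * k s) volume t T :=
    hint.mono_set (by rw [uIcc_of_le hT.le, uIcc_of_le htT.le]; exact Icc_subset_Icc_left ht0.le)
  -- For `s < t` one has `(T/t)(t - s) ≤ T - s`, and the exponent `α - 1` is negative. The factor
  -- `(T/t) ^ (α - 1)` is also the ratio of the left sides of the two equations.
  have hL : ∫ s in (0 : ℝ)..t, (T - s) ^ (α - 1) * k s ≤
      (T / t) ^ (α - 1) * ∫ s in (0 : ℝ)..t, (t - s) ^ (α - 1) * k s := by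
    rw [← intervalIntegral.integral_const_mul]
    refine intervalIntegral.integral_mono_on_of_le_Ioo ht0.le hintL
      ((intervalIntegrable_mlPow hα hα hα ht0 lam).const_mul _) fun s hs => ?_
    have hks : 0 < k s := hpos s ⟨hs.1, hs.2.trans htT⟩
    rw [← mul_assoc, ← Real.mul_rpow (by positivity) (by linarith [hs.2])]
    refine mul_le_mul_of_nonneg_right ?_ hks.le
    refine Real.rpow_le_rpow_of_nonpos (mul_pos (by positivity) (by linarith [hs.2])) ?_
      (by linarith)
    have h1 : T / t * (t - s) = T - s * (T / t) := by field_simp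
    have h2 : 1 ≤ T / t := (one_le_div ht0).2 htT.le
    nlinarith [hs.1]
  have hR : ∫ s in t..T, (T - s) ^ (α - 1) * k s ≤ k t * ((T - t) ^ α / α) := by
    rw [← integral_sub_rpow hα, ← intervalIntegral.integral_const_mul]
    refine intervalIntegral.integral_mono_on_of_le_Ioo htT.le hintR
      ((intervalIntegrable_sub_rpow hα).const_mul _) fun s hs => ?_
    rw [mul_comm (k t)]
    exact mul_le_mul_of_nonneg_left (htmax ⟨by linarith [htI.1, hs.1], hs.2.le⟩)
      (Real.rpow_nonneg (by linarith [hs.2]) _)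
  have hVT := mlPow_volterra hα hT lam
  have hVt := mlPow_volterra hα ht0 lam
  rw [← hkdef, ← intervalIntegral.integral_add_adjacent_intervals hintL hintR] at hVT
  rw [← hkdef] at hVt
  have hratio : T ^ (α - 1) = (T / t) ^ (α - 1) * t ^ (α - 1) := by
    rw [← Real.mul_rpow (by positivity) ht0.le, div_mul_cancel₀ _ ht0.ne']
  have hhalf : 1 / 2 ≤ (T / t) ^ (α - 1) := by
    have h2 : T / t ≤ 2 := (div_le_iff₀ ht0).2 (by linarith [htI.1])
    calc (1 / 2 : ℝ) = 2 ^ (-1 : ℝ) := by rw [Real.rpow_neg_one]; norm_num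
      _ ≤ 2 ^ (α - 1) := Real.rpow_le_rpow_of_exponent_le (by norm_num) (by linarith)
      _ ≤ _ := Real.rpow_le_rpow_of_nonpos (by positivity) h2 (by linarith)
  have hηt : (T - t) ^ α / α ≤ η ^ α / α := by
    gcongr
    linarith [htI.1]
  have hL' := mul_le_mul_of_nonneg_left hL hlam
  have hR' := mul_le_mul_of_nonneg_left hR hlam
  -- Subtract `(T/t) ^ (α - 1)` times the equation at `t` from the one at `T`: the history before
  -- `t` drops out by `hL`, and `k T ≤ 0` removes its own term.
  have h1 : (T / t) ^ (α - 1) * (Real.Gamma α * k t) ≤ lam * (k t * ((T - t) ^ α / α)) := by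
    have h3 : Real.Gamma α * k T ≤ 0 := mul_nonpos_of_nonneg_of_nonpos hG.le hk
    rw [hVt] at hratio
    nlinarith
  have h2 : 1 / 2 * (Real.Gamma α * k t) ≤ (T / t) ^ (α - 1) * (Real.Gamma α * k t) :=
    mul_le_mul_of_nonneg_right hhalf (by positivity)
  have h3 : lam * (k t * ((T - t) ^ α / α)) ≤ k t * (lam * (η ^ α / α)) := by
    have := mul_le_mul_of_nonneg_left hηt (mul_nonneg hlam hmid.le)
    linarith
  have h4 : k t * (lam * (η ^ α / α)) < k t * (Real.Gamma α / 2) :=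
    mul_lt_mul_of_pos_left hη hmid
  linarith

/-- Otherwise the nonpositive points have a least element. Searching from `ε / 2` avoids the
singularity at 0 and loses nothing, since the kernel is positive before `ε`. -/
theorem mlPow_self_pos {α lam t : ℝ} (hα : 0 < α) (hα1 : α < 1) (hlam : 0 ≤ lam) (ht : 0 < t) :
    0 < mlPow α α lam t := by
  by_contra! hneg
  obtain ⟨ε, hε, hnear⟩ := mlPow_self_pos_near_zero hα lam
  set S := Icc (ε / 2) t ∩ mlPow α α lam ⁻¹' Iic 0 with hS
  have hcont : ContinuousOn (mlPow α α lam) (Icc (ε / 2) t) :=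
    (continuousOn_mlPow hα α lam).mono fun x hx => lt_of_lt_of_le (by positivity) hx.1
  have hclosed : IsClosed S := hcont.preimage_isClosed_of_isClosed isClosed_Icc isClosed_Iic
  have hεt : ε ≤ t := by
    by_contra! h
    exact absurd hneg (not_le.2 (hnear t ⟨ht, h⟩))
  have htS : t ∈ S := ⟨⟨by linarith, le_rfl⟩, hneg⟩
  have hbdd : BddBelow S := ⟨ε / 2, fun x hx => hx.1.1⟩
  have hmem : sInf S ∈ S := hclosed.csInf_mem ⟨t, htS⟩ hbdd
  have hT : 0 < sInf S := lt_of_lt_of_le (by positivity) hmem.1.1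
  refine not_mlPow_self_nonpos hα hα1 hlam hT (fun s hs => ?_) hmem.2
  by_contra! hs'
  rcases lt_or_ge s ε with h | h
  · exact absurd hs' (not_le.2 (hnear s ⟨hs.1, h⟩))
  · exact absurd (csInf_le hbdd (show s ∈ S from
      ⟨⟨by linarith, hs.2.le.trans hmem.1.2⟩, hs'⟩)) (not_le.2 hs.2)

/-! ### Monotonicity and two-sided bounds of the relaxation functions. -/

/-- The integral term of the Volterra equation is nonnegative. This majorant, uniform in `lam`,
later dominates the differentiated series. -/
theorem mlPow_self_le {α lam t : ℝ} (hα : 0 < α) (hα1 : α < 1) (hlam : 0 ≤ lam) (ht : 0 < t) :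
    mlPow α α lam t ≤ t ^ (α - 1) / Real.Gamma α := by
  rw [le_div_iff₀ (Real.Gamma_pos_of_pos hα), mlPow_volterra hα ht lam]
  have : 0 ≤ ∫ s in (0 : ℝ)..t, (t - s) ^ (α - 1) * mlPow α α lam s := by
    refine intervalIntegral.integral_nonneg_of_ae_restrict ht.le ?_
    rw [Measure.restrict_congr_set Ioo_ae_eq_Icc.symm]
    filter_upwards [self_mem_ae_restrict measurableSet_Ioo] with s hs
    exact mul_nonneg (Real.rpow_nonneg (by linarith [hs.2]) _)
      (mlPow_self_pos hα hα1 hlam hs.1).le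
  nlinarith [mul_nonneg hlam this]

/-- Since `-lam * mlPow α α lam` is the derivative of `mlPow α 1 lam`, this computes the Caputo
derivative of the latter. -/
theorem integral_mlPow_self_caputo {α t : ℝ} (hα : 0 < α) (hα1 : α < 1) (ht : 0 < t) (lam : ℝ) :
    ∫ s in (0 : ℝ)..t, (t - s) ^ (-α) * mlPow α α lam s =
      Real.Gamma (1 - α) * mlPow α 1 lam t := by
  have h := integral_mlPow (b := 1 - α) hα hα (by linarith) ht lam
  rwa [show α + (1 - α) = 1 by ring, show 1 - α - 1 = -α by ring] at h

theorem intervalIntegrable_mlPow_self_caputo {α t : ℝ} (hα : 0 < α) (hα1 : α < 1) (ht : 0 < t)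
    (lam : ℝ) :
    IntervalIntegrable (fun s => (t - s) ^ (-α) * mlPow α α lam s) volume 0 t := by
  have h := intervalIntegrable_mlPow (b := 1 - α) hα hα (by linarith) ht lam
  rwa [show 1 - α - 1 = -α by ring] at h

theorem mlPow_one_nonneg {α lam t : ℝ} (hα : 0 < α) (hα1 : α < 1) (hlam : 0 ≤ lam) (ht : 0 < t) :
    0 ≤ mlPow α 1 lam t := by
  have hG : 0 < Real.Gamma (1 - α) := Real.Gamma_pos_of_pos (by linarith)
  have h := integral_mlPow_self_caputo hα hα1 ht lam
  have : 0 ≤ ∫ s in (0 : ℝ)..t, (t - s) ^ (-α) * mlPow α α lam s := by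
    refine intervalIntegral.integral_nonneg_of_ae_restrict ht.le ?_
    rw [Measure.restrict_congr_set Ioo_ae_eq_Icc.symm]
    filter_upwards [self_mem_ae_restrict measurableSet_Ioo] with s hs
    exact mul_nonneg (Real.rpow_nonneg (by linarith [hs.2]) _)
      (mlPow_self_pos hα hα1 hlam hs.1).le
  rw [h] at this
  exact nonneg_of_mul_nonneg_right this hG

theorem intervalIntegrable_mlPow_self {α t : ℝ} (hα : 0 < α) (ht : 0 < t) (lam : ℝ) :
    IntervalIntegrable (mlPow α α lam) volume 0 t := by
  simpa using intervalIntegrable_mlPow (b := 1) hα hα one_pos ht lam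

theorem mlPow_one_eq {α t : ℝ} (hα : 0 < α) (ht : 0 < t) (lam : ℝ) :
    mlPow α 1 lam t = 1 - lam * ∫ s in (0 : ℝ)..t, mlPow α α lam s := by
  have h := integral_mlPow (b := 1) hα hα one_pos ht lam
  simp only [sub_self, Real.rpow_zero, one_mul, Real.Gamma_one] at h
  rw [h, mlPow_recurrence (γ := 1) hα ht, add_comm 1 α]
  simp

theorem hasDerivAt_mlPow_one {α t : ℝ} (hα : 0 < α) (ht : 0 < t) (lam : ℝ) :
    HasDerivAt (mlPow α 1 lam) (-(lam * mlPow α α lam t)) t := by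
  have hc := continuousOn_mlPow hα α lam
  have h := intervalIntegral.integral_hasDerivAt_right (intervalIntegrable_mlPow_self hα ht lam)
    (hc.stronglyMeasurableAtFilter isOpen_Ioi t ht) (hc.continuousAt (Ioi_mem_nhds ht))
  refine ((h.const_mul lam).const_sub 1).congr_of_eventuallyEq ?_
  filter_upwards [Ioi_mem_nhds ht] with s hs
  exact mlPow_one_eq hα hs lam

theorem mlPow_one_le_one {α lam t : ℝ} (hα : 0 < α) (hα1 : α < 1) (hlam : 0 ≤ lam) (ht : 0 < t) :
    mlPow α 1 lam t ≤ 1 := by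
  have : 0 ≤ ∫ s in (0 : ℝ)..t, mlPow α α lam s := by
    refine intervalIntegral.integral_nonneg_of_ae_restrict ht.le ?_
    rw [Measure.restrict_congr_set Ioo_ae_eq_Icc.symm]
    filter_upwards [self_mem_ae_restrict measurableSet_Ioo] with s hs
    exact (mlPow_self_pos hα hα1 hlam hs.1).le
  rw [mlPow_one_eq hα ht]
  nlinarith [mul_nonneg hlam this]

theorem antitoneOn_mlPow_one {α lam : ℝ} (hα : 0 < α) (hα1 : α < 1) (hlam : 0 ≤ lam) :
    AntitoneOn (mlPow α 1 lam) (Ioi 0) := by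
  refine antitoneOn_of_deriv_nonpos (convex_Ioi 0) (continuousOn_mlPow hα 1 lam) ?_ ?_ <;>
    rw [interior_Ioi]
  · exact fun x hx => (hasDerivAt_mlPow_one hα hx lam).differentiableAt.differentiableWithinAt
  · intro x hx
    rw [(hasDerivAt_mlPow_one hα hx lam).deriv]
    exact neg_nonpos.2 (mul_nonneg hlam (mlPow_self_pos hα hα1 hlam hx).le)

theorem mlPow_one_eq_sub_integral {α t : ℝ} (hα : 0 < α) (ht : 0 < t) (lam : ℝ) :
    mlPow α 1 lam t = 1 - lam / Real.Gamma α *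
      ∫ s in (0 : ℝ)..t, (t - s) ^ (α - 1) * mlPow α 1 lam s := by
  have hG := (Real.Gamma_pos_of_pos hα).ne'
  rw [integral_mlPow hα one_pos hα ht, mlPow_recurrence (γ := 1) hα ht]
  field_simp
  simp

/-- Replace the unknown by its bound 1 inside the integral equation `mlPow_one_eq_sub_integral`. -/
theorem one_sub_le_mlPow_one {α lam t : ℝ} (hα : 0 < α) (hα1 : α < 1) (hlam : 0 ≤ lam)
    (ht : 0 < t) : 1 - lam * t ^ α / Real.Gamma (α + 1) ≤ mlPow α 1 lam t := by
  have hG := Real.Gamma_pos_of_pos hα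
  have h : ∫ s in (0 : ℝ)..t, (t - s) ^ (α - 1) * mlPow α 1 lam s ≤ t ^ α / α := by
    have h0 := integral_sub_rpow (t := 0) (T := t) hα
    rw [sub_zero] at h0
    rw [← h0]
    refine intervalIntegral.integral_mono_on_of_le_Ioo ht.le
      (intervalIntegrable_mlPow hα one_pos hα ht lam) (intervalIntegrable_sub_rpow hα)
      fun s hs => ?_
    exact mul_le_of_le_one_right (Real.rpow_nonneg (by linarith [hs.2]) _)
      (mlPow_one_le_one hα hα1 hlam hs.1)
  rw [mlPow_one_eq_sub_integral hα ht, Real.Gamma_add_one hα.ne']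
  have e : lam * t ^ α / (α * Real.Gamma α) = lam / Real.Gamma α * (t ^ α / α) := by
    field_simp
  rw [e]
  linarith [mul_le_mul_of_nonneg_left h (div_nonneg hlam hG.le)]

/-- By monotonicity the unknown under the integral is at least its value at the endpoint `t`, which
can then be pulled out. -/
theorem mlPow_one_mul_le {α lam t : ℝ} (hα : 0 < α) (hα1 : α < 1) (hlam : 0 ≤ lam)
    (ht : 0 < t) : mlPow α 1 lam t * (1 + lam * t ^ α / Real.Gamma (α + 1)) ≤ 1 := by
  have hG := Real.Gamma_pos_of_pos hα
  have h : t ^ α / α * mlPow α 1 lam t ≤ ∫ s in (0 : ℝ)..t, (t - s) ^ (α - 1) * mlPow α 1 lam s := by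
    have h0 := integral_sub_rpow (t := 0) (T := t) hα
    rw [sub_zero] at h0
    rw [← h0, ← intervalIntegral.integral_mul_const]
    refine intervalIntegral.integral_mono_on_of_le_Ioo ht.le
      ((intervalIntegrable_sub_rpow hα).mul_const _)
      (intervalIntegrable_mlPow hα one_pos hα ht lam) fun s hs => ?_
    exact mul_le_mul_of_nonneg_left (antitoneOn_mlPow_one hα hα1 hlam hs.1 ht hs.2.le)
      (Real.rpow_nonneg (by linarith [hs.2]) _)
  have h2 := mlPow_one_eq_sub_integral hα ht lam
  have h3 := mul_le_mul_of_nonneg_left h (div_nonneg hlam hG.le)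
  rw [Real.Gamma_add_one hα.ne']
  have e : mlPow α 1 lam t * (1 + lam * t ^ α / (α * Real.Gamma α)) =
      mlPow α 1 lam t + lam / Real.Gamma α * (t ^ α / α * mlPow α 1 lam t) := by
    field_simp
  rw [e]
  linarith

/-! ### The Mittag-Leffler bounds and their constants. -/

theorem mittagLeffler_zero (α : ℝ) : mittagLeffler α 0 = 1 := by
  rw [mittagLeffler_eq, mittagLeffler₂_zero, Real.Gamma_one, one_div_one]

theorem mittagLeffler_neg_eq (α x : ℝ) : mittagLeffler α (-x) = mlPow α 1 x 1 := by
  simp [mlPow_one_right]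

theorem mittagLeffler_neg_nonneg {α x : ℝ} (hα : 0 < α) (hα1 : α < 1) (hx : 0 ≤ x) :
    0 ≤ mittagLeffler α (-x) := by
  rw [mittagLeffler_neg_eq]
  exact mlPow_one_nonneg hα hα1 hx one_pos

theorem mittagLeffler_neg_le_one {α x : ℝ} (hα : 0 < α) (hα1 : α < 1) (hx : 0 ≤ x) :
    mittagLeffler α (-x) ≤ 1 := by
  rw [mittagLeffler_neg_eq]
  exact mlPow_one_le_one hα hα1 hx one_pos

/-- `Γ` is convex and equals 1 at both 1 and 2. -/
theorem Gamma_add_one_le_one {α : ℝ} (hα : 0 < α) (hα1 : α < 1) : Real.Gamma (α + 1) ≤ 1 := by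
  have h := Real.convexOn_Gamma.2 (mem_Ioi.2 one_pos) (mem_Ioi.2 (two_pos : (0 : ℝ) < 2))
    (show 0 ≤ 1 - α by linarith) hα.le (by ring)
  simp only [smul_eq_mul, Real.Gamma_one, Real.Gamma_two] at h
  rw [show (1 - α) * 1 + α * 2 = α + 1 by ring] at h
  linarith

theorem mittagLeffler_neg_le_inv {α x : ℝ} (hα : 0 < α) (hα1 : α < 1) (hx : 0 ≤ x) :
    mittagLeffler α (-x) ≤ 1 / (1 + x) := by
  have h := mlPow_one_mul_le hα hα1 hx one_pos
  have h0 := mlPow_one_nonneg hα hα1 hx one_pos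
  rw [mittagLeffler_neg_eq, le_div_iff₀ (by positivity)]
  rw [Real.one_rpow, mul_one] at h
  refine le_trans (mul_le_mul_of_nonneg_left ?_ h0) h
  gcongr
  rw [le_div_iff₀ (Real.Gamma_pos_of_pos (by linarith))]
  exact mul_le_of_le_one_right hx (Gamma_add_one_le_one hα hα1)

theorem one_sub_mittagLeffler_neg {α : ℝ} (hα : 0 < α) (x : ℝ) :
    1 - mittagLeffler α (-x) = x * mittagLeffler₂ α (α + 1) (-x) := by
  rw [mittagLeffler_eq, mittagLeffler₂_recurrence hα, Real.Gamma_one]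
  ring

theorem exists_isUpperConst {α₀ α₁ : ℝ} (h0 : 0 < α₀) (h1 : α₁ < 1) :
    ∃ C₂ : ℝ, 0 < C₂ ∧ ∀ α ∈ Icc α₀ α₁, IsUpperConst α C₂ := by
  rcases lt_or_ge α₁ α₀ with h | h
  · exact ⟨1, one_pos, fun α hα => absurd (hα.1.trans hα.2) (not_le.2 h)⟩
  -- `Γ` decreases on `(0, 1]`, so this constant is at least `Γ(1 - α)` on the whole range and (2)
  -- follows from the bound `1 / (1 + x)`.
  refine ⟨Real.Gamma (1 - α₁), Real.Gamma_pos_of_pos (by linarith), fun α hα x hx => ?_⟩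
  have hα0 : 0 < α := h0.trans_le hα.1
  have hα1 : α < 1 := hα.2.trans_lt h1
  have hG : 0 < Real.Gamma (1 - α) := Real.Gamma_pos_of_pos (by linarith)
  have hmono : Real.Gamma (1 - α) ≤ Real.Gamma (1 - α₁) :=
    Real.Gamma_strictAntiOn_Ioc.antitoneOn ⟨by linarith, by linarith⟩ ⟨by linarith, by linarith⟩
      (by linarith [hα.2])
  refine (mittagLeffler_neg_le_inv hα0 hα1 hx.le).trans ?_
  rw [div_le_div_iff₀ (by positivity) (by positivity), one_mul]
  gcongr

theorem exists_isGenConst : ∃ C : ℝ, 0 < C ∧ ∀ α ∈ Ioo (0 : ℝ) 1, IsGenConst α C := by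
  obtain ⟨x₀, hx₀, hmin⟩ := Real.exists_isMinOn_Gamma_Ioi
  set m := Real.Gamma x₀ with hm
  have hm0 : 0 < m := Real.Gamma_pos_of_pos (by linarith [hx₀.1])
  -- `E_{α,α+1}(-x)` is at most `1/m`, with `m` the minimum of `Γ` on the positive axis, and `x`
  -- times it is at most 1. The constant `1/m + 1` would do; doubling it is harmless.
  refine ⟨2 / m + 2, by positivity, fun α hα x hx => ?_⟩
  obtain ⟨hα0, hα1⟩ := hα
  have hrel := one_sub_mittagLeffler_neg hα0 x
  have hE0 := mittagLeffler_neg_nonneg hα0 hα1 hx.le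
  have hE1 := mittagLeffler_neg_le_one hα0 hα1 hx.le
  have hpos : 0 ≤ mittagLeffler₂ α (α + 1) (-x) :=
    nonneg_of_mul_nonneg_right (by rw [← hrel]; linarith) hx
  rw [abs_of_nonneg hpos, le_div_iff₀ (by positivity)]
  have hle : mittagLeffler₂ α (α + 1) (-x) ≤ 1 / m := by
    have h := one_sub_le_mlPow_one hα0 hα1 hx.le one_pos
    rw [← mittagLeffler_neg_eq, Real.one_rpow, mul_one] at h
    have hGm : m ≤ Real.Gamma (α + 1) := hmin (show (0 : ℝ) < α + 1 by linarith)
    have h1 : x / Real.Gamma (α + 1) ≤ x * (1 / m) := by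
      rw [mul_one_div]; gcongr
    exact le_of_mul_le_mul_left (by linarith) hx
  have hm2 : 2 / m = 2 * (1 / m) := by ring
  rcases le_total x 1 with h | h
  · nlinarith [one_div_pos.2 hm0]
  · nlinarith [one_div_pos.2 hm0]

/-! ### The sines as a Hilbert basis of `L²[0, π]`. -/

theorem memLp_rod_of_continuous {w : ℝ → ℝ} (hw : Continuous w) : MemLp w 2 rodMeasure := by
  obtain ⟨B, hB⟩ := isCompact_Icc.exists_bound_of_continuousOn
    (s := Icc 0 Real.pi) hw.continuousOn
  refine MemLp.of_bound hw.aestronglyMeasurable B ?_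
  filter_upwards [self_mem_ae_restrict measurableSet_Icc] with x hx
  exact hB x hx

theorem inner_toLp (f : L2Rod) {w : ℝ → ℝ} (hw : MemLp w 2 rodMeasure) :
    inner ℝ f (hw.toLp w) = ∫ x, f x * w x ∂rodMeasure := by
  rw [L2.inner_def]
  refine integral_congr_ae ?_
  filter_upwards [hw.coeFn_toLp] with x hx
  rw [hx]
  simp [mul_comm]

theorem integral_rod (h : ℝ → ℝ) : ∫ x, h x ∂rodMeasure = ∫ x in (0 : ℝ)..Real.pi, h x := by
  rw [intervalIntegral.integral_of_le Real.pi_pos.le, integral_Icc_eq_integral_Ioc]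

theorem inner_sineBasis_toLp (n : ℕ) {w : ℝ → ℝ} (hw : MemLp w 2 rodMeasure) :
    inner ℝ (sineBasis n) (hw.toLp w) =
      ∫ x in (0 : ℝ)..Real.pi, Real.sqrt (2 / Real.pi) * Real.sin ((n + 1 : ℝ) * x) * w x := by
  rw [inner_toLp, ← integral_rod]
  refine integral_congr_ae ?_
  filter_upwards [(memLp_sine n).coeFn_toLp] with x hx
  rw [sineBasis, hx]

theorem integral_cos_int_mul (m : ℤ) :
    ∫ x in (0 : ℝ)..Real.pi, Real.cos (m * x) = if m = 0 then Real.pi else 0 := by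
  split_ifs with h
  · simp [h]
  · rw [intervalIntegral.integral_comp_mul_left (fun x => Real.cos x) (by exact_mod_cast h)]
    simp [integral_cos, Real.sin_int_mul_pi]

theorem orthonormal_sineBasis : Orthonormal ℝ sineBasis := by
  rw [orthonormal_iff_ite]
  intro i j
  conv_lhs => rw [show sineBasis j = (memLp_sine j).toLp _ from rfl]
  rw [inner_sineBasis_toLp]
  -- Product to sum. Frequencies are shifted by one, so the sum frequency `i + j + 2` never vanishes
  -- and the difference `i - j` does so only on the diagonal.
  have e : ∀ x : ℝ, Real.sqrt (2 / Real.pi) * Real.sin ((i + 1 : ℝ) * x) *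
      (Real.sqrt (2 / Real.pi) * Real.sin ((j + 1 : ℝ) * x)) =
      1 / Real.pi * (Real.cos (((i - j : ℤ) : ℝ) * x) - Real.cos (((i + j + 2 : ℤ) : ℝ) * x)) := by
    intro x
    have h1 : Real.sqrt (2 / Real.pi) * Real.sqrt (2 / Real.pi) = 2 / Real.pi :=
      Real.mul_self_sqrt (by positivity)
    have h2 : (((i - j : ℤ) : ℝ) * x) = (i + 1 : ℝ) * x - (j + 1 : ℝ) * x := by push_cast; ring
    have h3 : (((i + j + 2 : ℤ) : ℝ) * x) = (i + 1 : ℝ) * x + (j + 1 : ℝ) * x := by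
      push_cast; ring
    rw [h2, h3, Real.cos_sub, Real.cos_add]
    linear_combination (Real.sin ((i + 1 : ℝ) * x) * Real.sin ((j + 1 : ℝ) * x)) * h1
  simp_rw [e]
  rw [intervalIntegral.integral_const_mul, intervalIntegral.integral_sub
    (Continuous.intervalIntegrable (by fun_prop) _ _)
    (Continuous.intervalIntegrable (by fun_prop) _ _), integral_cos_int_mul, integral_cos_int_mul,
    if_neg (by omega : ¬((i : ℤ) + j + 2 = 0))]
  by_cases h : i = j
  · simp [h, Real.pi_ne_zero]
  · simp [h, sub_eq_zero]

theorem integrable_rod_mul (f : L2Rod) {h : ℝ → ℝ} (hh : Continuous h) :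
    Integrable (fun x => f x * h x) rodMeasure :=
  IntegrableOn.mul_continuousOn ((Lp.memLp f).integrable one_le_two) hh.continuousOn isCompact_Icc

section Completeness

variable {f : L2Rod}

theorem integral_mul_sin_eq_zero (hf : ∀ n, inner ℝ f (sineBasis n) = 0) (n : ℕ) :
    ∫ x, f x * Real.sin (n * x) ∂rodMeasure = 0 := by
  rcases n with _ | n
  · simp
  have h := hf n
  rw [sineBasis, inner_toLp] at h
  have e : ∀ x, f x * (Real.sqrt (2 / Real.pi) * Real.sin ((n + 1 : ℝ) * x)) =
      Real.sqrt (2 / Real.pi) * (f x * Real.sin ((n + 1 : ℝ) * x)) := fun x => by ring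
  simp_rw [e] at h
  rw [integral_const_mul, mul_eq_zero] at h
  have hs : Real.sqrt (2 / Real.pi) ≠ 0 := (Real.sqrt_pos.2 (by positivity)).ne'
  push_cast
  exact h.resolve_left hs

/-- Multiplying `sin (m x)` by `cos x` averages the neighbouring frequencies `m ± 1`. Frequency 0 is
included, where the sine vanishes, so that the induction closes. -/
theorem integral_mul_sin_mul_cos_pow_eq_zero (hf : ∀ n, inner ℝ f (sineBasis n) = 0) (k : ℕ) :
    ∀ n : ℕ, ∫ x, f x * (Real.sin (n * x) * Real.cos x ^ k) ∂rodMeasure = 0 := by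
  induction k with
  | zero => intro n; simpa using integral_mul_sin_eq_zero hf n
  | succ k ih =>
    intro n
    rcases n with _ | n
    · simp
    have e : ∀ x, f x * (Real.sin ((n + 1 : ℕ) * x) * Real.cos x ^ (k + 1)) =
        1 / 2 * (f x * (Real.sin ((n + 2 : ℕ) * x) * Real.cos x ^ k)) +
        1 / 2 * (f x * (Real.sin (n * x) * Real.cos x ^ k)) := by
      intro x
      have h1 : ((n + 2 : ℕ) : ℝ) * x = (n + 1 : ℕ) * x + x := by push_cast; ring
      have h2 : (n : ℝ) * x = (n + 1 : ℕ) * x - x := by push_cast; ring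
      rw [h1, h2, Real.sin_add, Real.sin_sub]
      ring
    simp_rw [e]
    rw [integral_add ((integrable_rod_mul f (by fun_prop)).const_mul _)
      ((integrable_rod_mul f (by fun_prop)).const_mul _), integral_const_mul, integral_const_mul,
      ih, ih]
    simp

theorem integral_mul_sin_mul_poly_cos_eq_zero (hf : ∀ n, inner ℝ f (sineBasis n) = 0)
    (p : Polynomial ℝ) :
    ∫ x, f x * (Real.sin x * p.eval (Real.cos x)) ∂rodMeasure = 0 := by
  induction p using Polynomial.induction_on' with
  | add p q hp hq =>
    simp_rw [Polynomial.eval_add, mul_add]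
    rw [integral_add (integrable_rod_mul f (by fun_prop)) (integrable_rod_mul f (by fun_prop)),
      hp, hq, add_zero]
  | monomial k a =>
    have e : ∀ x, f x * (Real.sin x * (Polynomial.monomial k a).eval (Real.cos x)) =
        a * (f x * (Real.sin ((1 : ℕ) * x) * Real.cos x ^ k)) := fun x => by
      rw [Polynomial.eval_monomial, Nat.cast_one, one_mul]; ring
    simp_rw [e]
    rw [integral_const_mul, integral_mul_sin_mul_cos_pow_eq_zero hf, mul_zero]

/-- On `[0, π]` every continuous function is a continuous function of `cos x`, so Weierstrass
approximation on `[-1, 1]` reduces to polynomials in `cos x`. The tolerance uses `B + 1` because `B`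
may be 0. -/
theorem integral_mul_sin_mul_eq_zero (hf : ∀ n, inner ℝ f (sineBasis n) = 0) {g : ℝ → ℝ}
    (hg : Continuous g) : ∫ x, f x * (Real.sin x * g x) ∂rodMeasure = 0 := by
  have hfi : Integrable (fun x => |f x|) rodMeasure :=
    ((Lp.memLp f).integrable one_le_two).abs
  refine abs_nonpos_iff.1 (le_of_forall_pos_le_add fun δ hδ => ?_)
  set B := ∫ x, |f x| ∂rodMeasure with hB
  have hB0 : 0 ≤ B := integral_nonneg fun x => abs_nonneg _
  obtain ⟨p, hp⟩ := exists_polynomial_near_of_continuousOn (-1) 1 (fun y => g (Real.arccos y))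
    (hg.comp Real.continuous_arccos).continuousOn (δ / (B + 1)) (by positivity)
  have hsub : ∫ x, f x * (Real.sin x * g x) ∂rodMeasure =
      ∫ x, f x * (Real.sin x * (g x - p.eval (Real.cos x))) ∂rodMeasure := by
    simp_rw [mul_sub]
    rw [integral_sub (integrable_rod_mul f (by fun_prop)) (integrable_rod_mul f (by fun_prop)),
      integral_mul_sin_mul_poly_cos_eq_zero hf, sub_zero]
  rw [hsub, zero_add]
  calc |∫ x, f x * (Real.sin x * (g x - p.eval (Real.cos x))) ∂rodMeasure|
      ≤ ∫ x, |f x| * (δ / (B + 1)) ∂rodMeasure := by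
        rw [← Real.norm_eq_abs]
        refine norm_integral_le_of_norm_le (hfi.mul_const _) ?_
        filter_upwards [self_mem_ae_restrict measurableSet_Icc] with x hx
        rw [norm_mul, norm_mul, Real.norm_eq_abs, Real.norm_eq_abs, Real.norm_eq_abs]
        have h1 := hp (Real.cos x) ⟨Real.neg_one_le_cos x, Real.cos_le_one x⟩
        simp only [Real.arccos_cos hx.1 hx.2] at h1
        rw [abs_sub_comm] at h1
        refine mul_le_mul_of_nonneg_left ?_ (abs_nonneg _)
        calc |Real.sin x| * |g x - p.eval (Real.cos x)| ≤ 1 * (δ / (B + 1)) := by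
              gcongr
              exact Real.abs_sin_le_one x
          _ = _ := one_mul _
    _ = B * (δ / (B + 1)) := integral_mul_const _ _
    _ ≤ δ := by
        rw [mul_div_assoc', div_le_iff₀ (by positivity)]
        nlinarith

/-- Testing against smooth functions gives `f sin = 0` almost everywhere, and the sine is positive
inside the interval. -/
theorem eq_zero_of_inner_sineBasis_eq_zero (hf : ∀ n, inner ℝ f (sineBasis n) = 0) : f = 0 := by
  have hloc : LocallyIntegrable (fun x => f x * Real.sin x) rodMeasure :=
    (integrable_rod_mul f Real.continuous_sin).locallyIntegrable
  have hae := ae_eq_zero_of_integral_contDiff_smul_eq_zero hloc fun g hg _ => by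
    have e : ∀ x, g x • (f x * Real.sin x) = f x * (Real.sin x * g x) := fun x => by
      rw [smul_eq_mul]; ring
    simp_rw [e]
    exact integral_mul_sin_mul_eq_zero hf hg.continuous
  rw [Lp.eq_zero_iff_ae_eq_zero]
  have hmem : ∀ᵐ x ∂rodMeasure, x ∈ Ioo 0 Real.pi := by
    rw [rodMeasure, Measure.restrict_congr_set Ioo_ae_eq_Icc.symm]
    exact self_mem_ae_restrict measurableSet_Ioo
  filter_upwards [hae, hmem] with x hx hxm
  exact (mul_eq_zero.1 hx).resolve_right (Real.sin_pos_of_pos_of_lt_pi hxm.1 hxm.2).ne'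

end Completeness

theorem span_sineBasis_orthogonal : (Submodule.span ℝ (range sineBasis))ᗮ = ⊥ := by
  rw [eq_bot_iff]
  intro f hf
  refine (Submodule.mem_bot ℝ).2 (eq_zero_of_inner_sineBasis_eq_zero fun n => ?_)
  rw [real_inner_comm]
  exact (Submodule.mem_orthogonal _ f).1 hf _ (Submodule.subset_span (mem_range_self n))

/-- The sines form a Hilbert basis of `L²[0, π]`. -/
def sineHilbertBasis : HilbertBasis ℕ ℝ L2Rod :=
  HilbertBasis.mkOfOrthogonalEqBot orthonormal_sineBasis span_sineBasis_orthogonal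

theorem coe_sineHilbertBasis : ⇑sineHilbertBasis = sineBasis :=
  HilbertBasis.coe_mkOfOrthogonalEqBot _ _

theorem hasSum_inner_mul_sine (f g : L2Rod) :
    HasSum (fun n => inner ℝ f (sineBasis n) * inner ℝ (sineBasis n) g) (inner ℝ f g) := by
  simpa only [coe_sineHilbertBasis] using sineHilbertBasis.hasSum_inner_mul_inner f g

theorem hasSum_sine_sq (f : L2Rod) :
    HasSum (fun n => (inner ℝ f (sineBasis n)) ^ 2) (‖f‖ ^ 2) := by
  have h := hasSum_inner_mul_sine f f
  rw [real_inner_self_eq_norm_sq] at h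
  refine h.congr_fun fun n => ?_
  rw [sq, real_inner_comm f]

theorem ext_inner_sine {f g : L2Rod}
    (h : ∀ n, inner ℝ f (sineBasis n) = inner ℝ g (sineBasis n)) : f = g := by
  refine sub_eq_zero.1 (eq_zero_of_inner_sineBasis_eq_zero fun n => ?_)
  rw [inner_sub_left, h, sub_self]

/-! ### Fourier multipliers and termwise Caputo differentiation. -/

/-- Fourier multipliers with bounded symbol converge. -/
theorem summable_multiplier {m : ℕ → ℝ} {B : ℝ} (hm : ∀ n, |m n| ≤ B) (f : L2Rod) :
    Summable fun n => (m n * inner ℝ f (sineBasis n)) • sineBasis n := by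
  have hiff := orthonormal_sineBasis.orthogonalFamily.summable_iff_norm_sq_summable
    fun n => m n * inner ℝ f (sineBasis n)
  simp only [LinearIsometry.toSpanSingleton_apply] at hiff
  refine hiff.2 ?_
  refine Summable.of_nonneg_of_le (fun n => by positivity) (fun n => ?_)
    ((hasSum_sine_sq f).summable.mul_left (B ^ 2))
  rw [norm_mul, mul_pow, Real.norm_eq_abs, Real.norm_eq_abs, sq_abs (inner ℝ f (sineBasis n))]
  gcongr
  exact hm n

theorem inner_multiplier {m : ℕ → ℝ} {B : ℝ} (hm : ∀ n, |m n| ≤ B) (f : L2Rod) (j : ℕ) :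
    inner ℝ (∑' n, (m n * inner ℝ f (sineBasis n)) • sineBasis n) (sineBasis j) =
      m j * inner ℝ f (sineBasis j) := by
  have h := (summable_multiplier hm f).hasSum.mapL (innerSL ℝ (sineBasis j))
  rw [real_inner_comm]
  have hj := orthonormal_iff_ite.1 orthonormal_sineBasis j
  simp only [innerSL_apply_apply, inner_smul_right, hj] at h
  refine h.unique ?_
  convert hasSum_single j fun n hn => ?_ using 1
  · simp
  · simp [hn.symm]

/-- Integration by parts: sine coefficients of a second derivative. -/
theorem inner_sineBasis_deriv_deriv {w : ℝ → ℝ} (hw : ContDiff ℝ 2 w) (h0 : w 0 = 0)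
    (hπ : w Real.pi = 0) (h1 : MemLp w 2 rodMeasure) (h2 : MemLp (deriv (deriv w)) 2 rodMeasure)
    (n : ℕ) :
    inner ℝ (sineBasis n) (h2.toLp _) = -(freq n) ^ 2 * inner ℝ (sineBasis n) (h1.toLp _) := by
  have hd1 : ContDiff ℝ 1 (deriv w) := by
    have := (contDiff_succ_iff_deriv (n := 1)).1 (by simpa [one_add_one_eq_two] using hw)
    exact this.2.2
  have hd2 : Continuous (deriv (deriv w)) := hd1.continuous_deriv le_rfl
  have hw1 : ∀ x, HasDerivAt w (deriv w x) x := fun x =>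
    (hw.differentiable (by norm_num) x).hasDerivAt
  have hw2 : ∀ x, HasDerivAt (deriv w) (deriv (deriv w) x) x := fun x =>
    (hd1.differentiable (by norm_num) x).hasDerivAt
  set a : ℝ := n + 1 with ha
  obtain ⟨c, hcdef⟩ : ∃ c, c = Real.sqrt (2 / Real.pi) := ⟨_, rfl⟩
  have hs : ∀ x, HasDerivAt (fun x => c * Real.sin (a * x)) (c * (Real.cos (a * x) * a)) x :=
    fun x => by
      have := ((Real.hasDerivAt_sin (a * x)).comp x ((hasDerivAt_id x).const_mul a)).const_mul c
      simpa using this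
  have hc : ∀ x, HasDerivAt (fun x => c * (Real.cos (a * x) * a))
      (c * (-Real.sin (a * x) * a * a)) x :=
    fun x => by
      have := (((Real.hasDerivAt_cos (a * x)).comp x
        ((hasDerivAt_id x).const_mul a)).mul_const a).const_mul c
      simpa using this
  have e1 := intervalIntegral.integral_mul_deriv_eq_deriv_mul (a := 0) (b := Real.pi)
    (fun x _ => hs x) (fun x _ => hw2 x) (Continuous.intervalIntegrable (by fun_prop) _ _)
    (hd2.intervalIntegrable _ _)
  have e2 := intervalIntegral.integral_mul_deriv_eq_deriv_mul (a := 0) (b := Real.pi)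
    (fun x _ => hc x) (fun x _ => hw1 x) (Continuous.intervalIntegrable (by fun_prop) _ _)
    (hd1.continuous.intervalIntegrable _ _)
  have hsin : Real.sin (a * Real.pi) = 0 := by
    have := Real.sin_nat_mul_pi (n + 1)
    push_cast at this
    exact this
  simp only [inner_sineBasis_toLp, freq, ← ha, ← hcdef]
  rw [e1, e2, h0, hπ, hsin]
  have e3 : ∀ x, c * (-Real.sin (a * x) * a * a) * w x = -(a ^ 2) * (c * Real.sin (a * x) * w x) :=
    fun x => by ring
  simp_rw [e3]
  rw [intervalIntegral.integral_const_mul]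
  simp

/-- Termwise Caputo differentiation of a series of relaxation functions. -/
theorem hasCaputoDerivOn_tsum {α : ℝ} (hα : 0 < α) (hα1 : α < 1) {lam b : ℕ → ℝ} {y : ℝ → ℝ}
    (hlam : ∀ n, 0 ≤ lam n) (ha : Summable fun n => lam n * b n)
    (hy : ∀ t, 0 < t → HasSum (fun n => mlPow α 1 (lam n) t * b n) (y t)) :
    HasCaputoDerivOn α y (fun t => ∑' n, mlPow α 1 (lam n) t * -(lam n * b n)) := by
  have hG := Real.Gamma_pos_of_pos hα
  have hG1 : 0 < Real.Gamma (1 - α) := Real.Gamma_pos_of_pos (by linarith)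
  obtain ⟨a, hadef⟩ : ∃ a : ℕ → ℝ, a = fun n => -(lam n * b n) := ⟨_, rfl⟩
  have han : ∀ n, -(lam n * b n) = a n := fun n => by rw [hadef]
  have habs : Summable fun n => |a n| := by rw [hadef]; exact ha.neg.abs
  have hk : ∀ n t, 0 < t → |mlPow α α (lam n) t * a n| ≤ t ^ (α - 1) / Real.Gamma α * |a n| :=
    fun n t ht => by
      rw [abs_mul, abs_of_pos (mlPow_self_pos hα hα1 (hlam n) ht)]
      exact mul_le_mul_of_nonneg_right (mlPow_self_le hα hα1 (hlam n) ht) (abs_nonneg _)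
  have hder : ∀ t, 0 < t → HasDerivAt y (∑' n, mlPow α α (lam n) t * a n) t := by
    intro t ht
    -- The majorant blows up at 0, so domination is uniform only away from it; `(t / 2, ∞)`
    -- suffices.
    have h := hasDerivAt_tsum_of_isPreconnected
      (u := fun n => (t / 2) ^ (α - 1) / Real.Gamma α * |a n|)
      (g := fun n s => mlPow α 1 (lam n) s * b n) (g' := fun n s => mlPow α α (lam n) s * a n)
      (t := Ioi (t / 2)) (y₀ := t) (y := t) (habs.mul_left _) isOpen_Ioi isPreconnected_Ioi
      (fun n s hs => by
        have hs0 : 0 < s := lt_trans (by positivity) (mem_Ioi.1 hs)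
        refine ((hasDerivAt_mlPow_one hα hs0 (lam n)).mul_const (b n)).congr_deriv ?_
        rw [← han]; ring)
      (fun n s hs => by
        have hs0 : t / 2 < s := hs
        refine (hk n s (lt_trans (by positivity) hs0)).trans ?_
        refine mul_le_mul_of_nonneg_right (div_le_div_of_nonneg_right ?_ hG.le) (abs_nonneg _)
        exact Real.rpow_le_rpow_of_nonpos (by positivity) hs0.le (by linarith))
      (by simp [ht]) (hy t ht).summable (by simp [ht])
    refine h.congr_of_eventuallyEq ?_
    filter_upwards [Ioi_mem_nhds ht] with s hs
    exact (hy s hs).tsum_eq.symm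
  have hbound : ∀ t, 0 < t → |deriv y t| ≤ t ^ (α - 1) / Real.Gamma α * ∑' n, |a n| := by
    intro t ht
    rw [(hder t ht).deriv]
    exact tsum_of_norm_bounded (f := fun n => mlPow α α (lam n) t * a n)
      (habs.hasSum.mul_left (t ^ (α - 1) / Real.Gamma α)) fun n => hk n t ht
  intro t ht
  refine ⟨(hder t ht).differentiableAt, ?_, ?_⟩
  -- The derivative is bounded by a multiple of `s ^ (α - 1)`, so a Beta integrand dominates.
  · have h1 := ((intervalIntegrable_rpow_mul_rpow (b := 1 - α) hα (by linarith) ht).mul_const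
      (∑' n, |a n|)).div_const (Real.Gamma α)
    rw [intervalIntegrable_iff_integrableOn_Ioc_of_le ht.le] at h1 ⊢
    refine h1.mono' ?_ ?_
    · exact ((measurable_deriv y).div
        ((measurable_const.sub measurable_id).pow_const α)).aestronglyMeasurable
    · filter_upwards [self_mem_ae_restrict measurableSet_Ioc] with s hs
      have hts : 0 ≤ t - s := by linarith [hs.2]
      rw [norm_div, Real.norm_eq_abs, Real.norm_of_nonneg (Real.rpow_nonneg hts _),
        show 1 - α - 1 = -α by ring, Real.rpow_neg hts]
      calc |deriv y s| / (t - s) ^ α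
          ≤ (s ^ (α - 1) / Real.Gamma α * ∑' n, |a n|) / (t - s) ^ α :=
            div_le_div_of_nonneg_right (hbound s hs.1) (Real.rpow_nonneg hts _)
        _ = _ := by ring
  · have hI : ∀ n, IntegrableOn (fun s => (t - s) ^ (-α) * mlPow α α (lam n) s * a n) (Ioc 0 t) :=
      fun n => (intervalIntegrable_iff_integrableOn_Ioc_of_le ht.le).1
        ((intervalIntegrable_mlPow_self_caputo hα hα1 ht (lam n)).mul_const _)
    have hval : ∀ n, ∫ s in Ioc 0 t, (t - s) ^ (-α) * mlPow α α (lam n) s =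
        Real.Gamma (1 - α) * mlPow α 1 (lam n) t := fun n => by
      rw [← intervalIntegral.integral_of_le ht.le, integral_mlPow_self_caputo hα hα1 ht]
    have hsum : Summable fun n => ∫ s in Ioc 0 t,
        ‖(t - s) ^ (-α) * mlPow α α (lam n) s * a n‖ := by
      refine Summable.of_nonneg_of_le (fun n => integral_nonneg fun _ => norm_nonneg _)
        (fun n => ?_) (habs.mul_left (Real.Gamma (1 - α)))
      have e : ∀ s ∈ Ioc 0 t, ‖(t - s) ^ (-α) * mlPow α α (lam n) s * a n‖ =
          (t - s) ^ (-α) * mlPow α α (lam n) s * |a n| := fun s hs => by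
        rw [norm_mul, Real.norm_eq_abs (a n), Real.norm_of_nonneg]
        exact mul_nonneg (Real.rpow_nonneg (by linarith [hs.2]) _)
          (mlPow_self_pos hα hα1 (hlam n) hs.1).le
      rw [setIntegral_congr_fun measurableSet_Ioc e, integral_mul_const, hval]
      have := mlPow_one_le_one hα hα1 (hlam n) ht
      gcongr
      exact mul_le_of_le_one_right hG1.le this
    have key := hasSum_integral_of_summable_integral_norm hI hsum
    have e1 : ∫ s in (0 : ℝ)..t, deriv y s / (t - s) ^ α =
        ∫ s in Ioc 0 t, ∑' n, (t - s) ^ (-α) * mlPow α α (lam n) s * a n := by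
      rw [intervalIntegral.integral_of_le ht.le]
      refine setIntegral_congr_fun measurableSet_Ioc fun s hs => ?_
      simp only [mul_assoc]
      rw [(hder s hs.1).deriv, tsum_mul_left, Real.rpow_neg (by linarith [hs.2])]
      ring
    rw [e1, ← key.tsum_eq, ← tsum_mul_left]
    refine tsum_congr fun n => ?_
    rw [integral_mul_const, hval, han]
    field_simp

theorem freq_pos (n : ℕ) : 0 < freq n := by
  unfold freq; positivity

/-! ### The series solution: source estimate, continuity and weak formulation. -/

section Solution

variable {α : ℝ}

theorem relaxation_nonneg (hα : 0 < α) (hα1 : α < 1) (n : ℕ) {t : ℝ} (ht : 0 ≤ t) :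
    0 ≤ mittagLeffler α (-(freq n) ^ 2 * t ^ α) := by
  rw [neg_mul]
  exact mittagLeffler_neg_nonneg hα hα1 (by positivity)

theorem relaxation_le_one (hα : 0 < α) (hα1 : α < 1) (n : ℕ) {t : ℝ} (ht : 0 ≤ t) :
    mittagLeffler α (-(freq n) ^ 2 * t ^ α) ≤ 1 := by
  rw [neg_mul]
  exact mittagLeffler_neg_le_one hα hα1 (by positivity)

theorem abs_relaxation_le_one (hα : 0 < α) (hα1 : α < 1) {t : ℝ} (ht : 0 ≤ t) (n : ℕ) :
    |mittagLeffler α (-(freq n) ^ 2 * t ^ α)| ≤ 1 := by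
  rw [abs_of_nonneg (relaxation_nonneg hα hα1 n ht)]
  exact relaxation_le_one hα hα1 n ht

theorem inner_fracHeatSol (hα : 0 < α) (hα1 : α < 1) (f : L2Rod) {t : ℝ} (ht : 0 ≤ t) (n : ℕ) :
    inner ℝ (fracHeatSol α f t) (sineBasis n) =
      mittagLeffler α (-(freq n) ^ 2 * t ^ α) * inner ℝ f (sineBasis n) :=
  inner_multiplier (abs_relaxation_le_one hα hα1 ht) f n

theorem inner_sourceOp (hα : 0 < α) (hα1 : α < 1) (f : L2Rod) {τ : ℝ} (hτ : 0 ≤ τ) (n : ℕ) :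
    inner ℝ (sourceOp α τ f) (sineBasis n) =
      mittagLeffler α (-(freq n) ^ 2 * τ ^ α) * inner ℝ f (sineBasis n) :=
  inner_multiplier (abs_relaxation_le_one hα hα1 hτ) f n

theorem fracHeatSol_zero (hα : 0 < α) (hα1 : α < 1) (f : L2Rod) : fracHeatSol α f 0 = f := by
  refine ext_inner_sine fun n => ?_
  rw [inner_fracHeatSol hα hα1 f le_rfl, Real.zero_rpow hα.ne', mul_zero, mittagLeffler_zero,
    one_mul]

theorem norm_le_of_abs_inner_sine_le {f g : L2Rod} {B : ℝ} (hB : 0 ≤ B)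
    (h : ∀ n, |inner ℝ f (sineBasis n)| ≤ B * |inner ℝ g (sineBasis n)|) : ‖f‖ ≤ B * ‖g‖ := by
  refine le_of_sq_le_sq ?_ (by positivity)
  rw [mul_pow]
  refine hasSum_le (fun n => ?_) (hasSum_sine_sq f) ((hasSum_sine_sq g).mul_left (B ^ 2))
  rw [← mul_pow]
  refine sq_le_sq.2 ?_
  rw [abs_mul, abs_of_nonneg hB]
  exact h n

theorem norm_fracHeatSol_sub_le {τ ρ C C₂ : ℝ} (hα : 0 < α) (hα1 : α < 1) (hτ : 0 < τ)
    (hC : 0 < C) (hC₂ : 0 < C₂) (hgen : IsGenConst α C) (hup : IsUpperConst α C₂)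
    {f : L2Rod} (hf : f ∈ sourceSet α τ ρ) {t : ℝ} (ht : 0 ≤ t) :
    ‖fracHeatSol α f t - f‖ ≤ ρ * (C * C₂ / Real.Gamma (1 - α)) * (t ^ α / τ ^ α) := by
  obtain ⟨u, hu, rfl⟩ := hf
  have hG1 : 0 < Real.Gamma (1 - α) := Real.Gamma_pos_of_pos (by linarith)
  have hτα : 0 < τ ^ α := Real.rpow_pos_of_pos hτ _
  have htα : 0 ≤ t ^ α := Real.rpow_nonneg ht _
  set B := C * C₂ / Real.Gamma (1 - α) * (t ^ α / τ ^ α) with hB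
  have hB0 : 0 ≤ B := by positivity
  have key : ‖fracHeatSol α (sourceOp α τ u) t - sourceOp α τ u‖ ≤ B * ‖u‖ := by
    refine norm_le_of_abs_inner_sine_le hB0 fun n => ?_
    rw [inner_sub_left, inner_fracHeatSol hα hα1 _ ht, inner_sourceOp hα hα1 _ hτ.le,
      ← sub_one_mul, ← mul_assoc, abs_mul]
    refine mul_le_mul_of_nonneg_right ?_ (abs_nonneg _)
    have hn : 0 < freq n ^ 2 := pow_pos (freq_pos n) 2
    set x := freq n ^ 2 * t ^ α with hx
    set X := freq n ^ 2 * τ ^ α with hX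
    have hX0 : 0 < X := mul_pos hn hτα
    have h1 : |mittagLeffler α (-(freq n) ^ 2 * t ^ α) - 1| ≤ x * C := by
      rw [neg_mul, ← hx, abs_sub_comm, one_sub_mittagLeffler_neg hα, abs_mul]
      -- The hypothesis on `C` covers only `x > 0`; `x = 0` occurs at `t = 0`.
      rcases (by positivity : 0 ≤ x).eq_or_lt with h0 | h0
      · rw [← h0]; simp
      rw [abs_of_pos h0]
      refine mul_le_mul_of_nonneg_left ((hgen x h0).trans ?_) h0.le
      exact div_le_self hC.le (by linarith)
    have h2 : |mittagLeffler α (-(freq n) ^ 2 * τ ^ α)| ≤ C₂ / (Real.Gamma (1 - α) * X) := by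
      rw [abs_of_nonneg (relaxation_nonneg hα hα1 n hτ.le), neg_mul, ← hX]
      refine (hup X hX0).trans ?_
      gcongr
      linarith
    rw [abs_mul]
    calc _ ≤ x * C * (C₂ / (Real.Gamma (1 - α) * X)) := by gcongr
      _ = B := by
        have := (freq_pos n).ne'
        rw [hB, hx, hX]
        field_simp
  calc _ ≤ B * ‖u‖ := key
    _ ≤ B * ρ := by gcongr
    _ = _ := by rw [hB]; ring

/-- Parseval turns the squared distance into a series dominated by the squared coefficients of `f`,
each term of which tends to 0. -/
theorem continuousOn_fracHeatSol (hα : 0 < α) (hα1 : α < 1) (f : L2Rod) :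
    ContinuousOn (fracHeatSol α f) (Ici 0) := by
  intro t₀ ht₀
  have hsq : Tendsto (fun t => ‖fracHeatSol α f t - fracHeatSol α f t₀‖ ^ 2) (𝓝[Ici 0] t₀)
      (𝓝 0) := by
    have h := tendsto_tsum_of_dominated_convergence (𝓕 := 𝓝[Ici 0] t₀)
      (f := fun t n => ((mittagLeffler α (-(freq n) ^ 2 * t ^ α) -
        mittagLeffler α (-(freq n) ^ 2 * t₀ ^ α)) * inner ℝ f (sineBasis n)) ^ 2)
      (g := fun _ => (0 : ℝ)) (hasSum_sine_sq f).summable (fun n => ?_) ?_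
    · rw [tsum_zero] at h
      refine h.congr' ?_
      filter_upwards [self_mem_nhdsWithin] with t ht
      rw [← (hasSum_sine_sq _).tsum_eq]
      refine tsum_congr fun n => ?_
      rw [inner_sub_left, inner_fracHeatSol hα hα1 f ht, inner_fracHeatSol hα hα1 f ht₀, sub_mul]
    · have hc : Continuous fun t : ℝ => ((mittagLeffler α (-(freq n) ^ 2 * t ^ α) -
          mittagLeffler α (-(freq n) ^ 2 * t₀ ^ α)) * inner ℝ f (sineBasis n)) ^ 2 := by
        simp only [mittagLeffler_eq]
        have := (continuous_mittagLeffler₂ hα 1).comp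
          (continuous_const.mul (Real.continuous_rpow_const hα.le) :
            Continuous fun t : ℝ => -(freq n) ^ 2 * t ^ α)
        exact ((this.sub continuous_const).mul continuous_const).pow 2
      have := hc.tendsto t₀
      simp only [sub_self, zero_mul, ne_eq, OfNat.ofNat_ne_zero, not_false_eq_true, zero_pow]
        at this
      exact this.mono_left nhdsWithin_le_nhds
    · filter_upwards [self_mem_nhdsWithin] with t ht n
      rw [Real.norm_of_nonneg (sq_nonneg _), mul_pow]
      refine mul_le_of_le_one_left (sq_nonneg _) ?_
      rw [sq_le_one_iff_abs_le_one, abs_le]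
      have h1 := relaxation_nonneg hα hα1 n (mem_Ici.1 ht)
      have h2 := relaxation_le_one hα hα1 n (mem_Ici.1 ht)
      have h3 := relaxation_nonneg hα hα1 n (mem_Ici.1 ht₀)
      have h4 := relaxation_le_one hα hα1 n (mem_Ici.1 ht₀)
      constructor <;> linarith
  have h := hsq.sqrt
  simp only [Real.sqrt_sq (norm_nonneg _), Real.sqrt_zero] at h
  exact tendsto_iff_norm_sub_tendsto_zero.2 h

theorem isWeakSolution_fracHeatSol (hα : 0 < α) (hα1 : α < 1) (f : L2Rod) :
    IsWeakSolution α f (fracHeatSol α f) where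
  initial := fracHeatSol_zero hα hα1 f
  continuousOn := continuousOn_fracHeatSol hα hα1 f
  equation := by
    intro w hw h0 hπ
    have hd : Continuous (deriv (deriv w)) := by
      have := hw.continuous_iteratedDeriv 2 le_rfl
      rwa [iteratedDeriv_succ, iteratedDeriv_one] at this
    have hm := memLp_rod_of_continuous hw.continuous
    have hm2 := memLp_rod_of_continuous hd
    have hcoef := inner_sineBasis_deriv_deriv hw h0 hπ hm hm2
    have hexp : ∀ (g : L2Rod) (t : ℝ), 0 < t → HasSum (fun n => mlPow α 1 (freq n ^ 2) t *
        (inner ℝ f (sineBasis n) * inner ℝ (sineBasis n) g)) (inner ℝ (fracHeatSol α f t) g) := by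
      intro g t ht
      refine (hasSum_inner_mul_sine (fracHeatSol α f t) g).congr_fun fun n => ?_
      rw [inner_fracHeatSol hα hα1 f ht.le, mlPow_one_right, mul_assoc]
    -- The growing factor `λ²` passes to `w''`, whose coefficients are square summable; here the
    -- boundary values of `w` enter.
    have hprod : ∀ n, -(freq n ^ 2 * (inner ℝ f (sineBasis n) * inner ℝ (sineBasis n) (hm.toLp w)))
        = inner ℝ f (sineBasis n) * inner ℝ (sineBasis n) (hm2.toLp _) := fun n => by
      rw [hcoef]; ring
    have h := hasCaputoDerivOn_tsum hα hα1 (lam := fun n => freq n ^ 2)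
      (b := fun n => inner ℝ f (sineBasis n) * inner ℝ (sineBasis n) (hm.toLp w))
      (y := fun t => ∫ x, fracHeatSol α f t x * w x ∂rodMeasure) (fun n => sq_nonneg _)
      (by
        refine (hasSum_inner_mul_sine f (hm2.toLp _)).summable.neg.congr fun n => ?_
        rw [← hprod, neg_neg])
      (fun t ht => by
        rw [← inner_toLp _ hm]
        exact hexp _ t ht)
    intro t ht
    obtain ⟨h1, h2, h3⟩ := h t ht
    refine ⟨h1, h2, h3.trans ?_⟩
    simp only
    rw [← inner_toLp _ hm2, ← (hexp _ t ht).tsum_eq]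
    exact tsum_congr fun n => by rw [hprod]

theorem isIndexFunction_rpow (hα : 0 < α) : IsIndexFunction (fun t => t ^ α) where
  nonneg := fun t ht => Real.rpow_nonneg ht.le _
  continuousOn := (Real.continuous_rpow_const hα.le).continuousOn
  strictMonoOn := (Real.strictMonoOn_rpow_Ici_of_exponent_pos hα).mono Ioi_subset_Ici_self
  tendsto_zero := by
    have h := (Real.continuous_rpow_const hα.le).tendsto 0
    rw [Real.zero_rpow hα.ne'] at h
    exact h.mono_left nhdsWithin_le_nhds

end Solution

/-! ### Uniqueness through Abel inversion and Volterra equations. -/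

section Volterra

variable {α : ℝ}

/-- The exponents add up to `-1`, so the value does not depend on `r` or `t`; this makes Abel
inversion work. -/
theorem integral_abel_kernel (hα : 0 < α) (hα1 : α < 1) {r t : ℝ} (hrt : r < t) :
    ∫ s in r..t, (t - s) ^ (α - 1) * (s - r) ^ (-α) = Real.Gamma α * Real.Gamma (1 - α) := by
  have h := integral_rpow_mul_rpow (a := 1 - α) (b := α) (t := t - r) (by linarith) hα
    (by linarith)
  have hs := intervalIntegral.integral_comp_sub_right (a := r) (b := t)
    (fun x => (t - r - x) ^ (α - 1) * x ^ (1 - α - 1)) r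
  rw [sub_self, h] at hs
  simp only [show 1 - α + α = 1 by ring, sub_self, Real.rpow_zero,
    Real.Gamma_one, one_mul, div_one, show 1 - α - 1 = -α by ring,
    show ∀ s, t - r - (s - r) = t - s from fun s => by ring] at hs
  exact hs

theorem intervalIntegrable_abel_kernel (hα : 0 < α) (hα1 : α < 1) {r t : ℝ} (hrt : r < t) :
    IntervalIntegrable (fun s => (t - s) ^ (α - 1) * (s - r) ^ (-α)) volume r t := by
  refine intervalIntegral.intervalIntegrable_of_integral_ne_zero ?_
  rw [integral_abel_kernel hα hα1 hrt]
  exact (mul_pos (Real.Gamma_pos_of_pos hα) (Real.Gamma_pos_of_pos (by linarith))).ne'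

/-- The fractional integral of order `α` inverts the Caputo derivative. -/
theorem eq_add_fracIntegral_of_hasCaputoDerivOn (hα : 0 < α) (hα1 : α < 1) {y g : ℝ → ℝ}
    (hc : ContinuousOn y (Ici 0)) (hy : HasCaputoDerivOn α y g) {t : ℝ} (ht : 0 < t) :
    y t = y 0 + 1 / Real.Gamma α * ∫ s in (0 : ℝ)..t, (t - s) ^ (α - 1) * g s := by
  have hG := Real.Gamma_pos_of_pos hα
  have hG1 : 0 < Real.Gamma (1 - α) := Real.Gamma_pos_of_pos (by linarith)
  -- Multiplying the integrable Caputo integrand by the continuous weight `(t - s) ^ α` recovers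
  -- `deriv y`.
  have hint : IntervalIntegrable (deriv y) volume 0 t := by
    have h := (hy t ht).2.1.mul_continuousOn (g := fun s => (t - s) ^ α)
      ((Real.continuous_rpow_const hα.le).comp (by fun_prop)).continuousOn
    rw [intervalIntegrable_iff_integrableOn_Ioo_of_le ht.le] at h ⊢
    refine h.congr_fun (fun s hs => ?_) measurableSet_Ioo
    have : 0 < (t - s) ^ α := Real.rpow_pos_of_pos (by linarith [hs.2]) _
    field_simp
  have hftc : ∫ s in (0 : ℝ)..t, deriv y s = y t - y 0 :=
    intervalIntegral.integral_eq_sub_of_hasDerivAt_of_le ht.le (hc.mono Icc_subset_Ici_self)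
      (fun s hs => (hy s hs.1).1.hasDerivAt) hint
  have hintOn : IntegrableOn (deriv y) (Ioo 0 t) :=
    (intervalIntegrable_iff_integrableOn_Ioo_of_le ht.le).1 hint
  -- The double integral over the triangle `r < s < t`. Integrating in `r` first gives the Caputo
  -- derivative, in `s` first the Abel constant times `deriv y`.
  set K : ℝ × ℝ → ℝ := {p : ℝ × ℝ | p.2 < p.1}.indicator
    fun p => (t - p.1) ^ (α - 1) * ((p.1 - p.2) ^ (-α) * deriv y p.2) with hK
  have hKmeas : Measurable K := by
    refine Measurable.indicator ?_ (measurableSet_lt measurable_snd measurable_fst)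
    have := measurable_deriv y
    fun_prop
  have hKs : ∀ r, (fun s => K (s, r)) = (Ioi r).indicator
      fun s => (t - s) ^ (α - 1) * (s - r) ^ (-α) * deriv y r := by
    intro r
    ext s
    simp only [hK, indicator, mem_ofPred_eq, mem_Ioi, mul_assoc]
  have hKr : ∀ s, (fun r => K (s, r)) = (Iio s).indicator
      fun r => (t - s) ^ (α - 1) * ((s - r) ^ (-α) * deriv y r) := by
    intro s
    ext r
    simp only [hK, indicator, mem_ofPred_eq, mem_Iio]
  have hset1 : ∀ r ∈ Ioo 0 t, Ioo 0 t ∩ Ioi r = Ioo r t := fun r hr => by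
    rw [Ioo_inter_Ioi, max_eq_right hr.1.le]
  have hset2 : ∀ s ∈ Ioo 0 t, Ioo 0 t ∩ Iio s = Ioo 0 s := fun s hs => by
    rw [Ioo_inter_Iio, min_eq_right hs.2.le]
  have hker : ∀ r ∈ Ioo 0 t, ∫ s in Ioo r t, (t - s) ^ (α - 1) * (s - r) ^ (-α) =
      Real.Gamma α * Real.Gamma (1 - α) := fun r hr => by
    rw [← integral_Ioc_eq_integral_Ioo, ← intervalIntegral.integral_of_le hr.2.le,
      integral_abel_kernel hα hα1 hr.2]
  have hKint : Integrable K ((volume.restrict (Ioo 0 t)).prod (volume.restrict (Ioo 0 t))) := by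
    rw [integrable_prod_iff' hKmeas.aestronglyMeasurable]
    constructor
    · filter_upwards [self_mem_ae_restrict measurableSet_Ioo] with r hr
      rw [hKs, integrable_indicator_iff measurableSet_Ioi, IntegrableOn,
        Measure.restrict_restrict measurableSet_Ioi, inter_comm, hset1 r hr]
      exact ((intervalIntegrable_iff_integrableOn_Ioo_of_le hr.2.le).1
        (intervalIntegrable_abel_kernel hα hα1 hr.2)).mul_const _
    · refine (hintOn.norm.const_mul (Real.Gamma α * Real.Gamma (1 - α))).congr ?_
      filter_upwards [self_mem_ae_restrict measurableSet_Ioo] with r hr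
      have e : (fun s => ‖K (s, r)‖) = (Ioi r).indicator
          fun s => ‖(t - s) ^ (α - 1) * (s - r) ^ (-α) * deriv y r‖ := by
        ext s
        rw [← norm_indicator_eq_indicator_norm, ← hKs]
      rw [e, setIntegral_indicator measurableSet_Ioi, hset1 r hr, ← hker r hr,
        ← integral_mul_const]
      refine setIntegral_congr_fun measurableSet_Ioo fun s hs => ?_
      have h1 : 0 ≤ (t - s) ^ (α - 1) := Real.rpow_nonneg (by linarith [hs.2]) _
      have h2 : 0 ≤ (s - r) ^ (-α) := Real.rpow_nonneg (by linarith [hs.1]) _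
      rw [norm_mul, Real.norm_of_nonneg (mul_nonneg h1 h2)]
  have hswap := integral_integral_swap (f := fun s r => K (s, r)) hKint
  have hleft : ∫ s in Ioo 0 t, ∫ r in Ioo 0 t, K (s, r) =
      Real.Gamma (1 - α) * ∫ s in (0 : ℝ)..t, (t - s) ^ (α - 1) * g s := by
    rw [intervalIntegral.integral_of_le ht.le, integral_Ioc_eq_integral_Ioo, ← integral_const_mul]
    refine setIntegral_congr_fun measurableSet_Ioo fun s hs => ?_
    simp only [hKr]
    rw [setIntegral_indicator measurableSet_Iio, hset2 s hs, integral_const_mul,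
      ← (hy s hs.1).2.2, intervalIntegral.integral_of_le hs.1.le, integral_Ioc_eq_integral_Ioo]
    have e : ∫ r in Ioo 0 s, (s - r) ^ (-α) * deriv y r =
        ∫ r in Ioo 0 s, deriv y r / (s - r) ^ α := by
      refine setIntegral_congr_fun measurableSet_Ioo fun r hr => ?_
      rw [Real.rpow_neg (by linarith [hr.2])]
      ring
    rw [e]
    field_simp
  have hright : ∫ r in Ioo 0 t, ∫ s in Ioo 0 t, K (s, r) =
      Real.Gamma α * Real.Gamma (1 - α) * (y t - y 0) := by
    rw [← hftc, intervalIntegral.integral_of_le ht.le, integral_Ioc_eq_integral_Ioo,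
      ← integral_const_mul]
    refine setIntegral_congr_fun measurableSet_Ioo fun r hr => ?_
    simp only [hKs]
    rw [setIntegral_indicator measurableSet_Ioi, hset1 r hr, integral_mul_const, hker r hr]
  rw [hleft, hright] at hswap
  have h2 : ∫ s in (0 : ℝ)..t, (t - s) ^ (α - 1) * g s = Real.Gamma α * (y t - y 0) :=
    mul_left_cancel₀ hG1.ne' (by rw [hswap]; ring)
  rw [h2]
  field_simp
  ring

theorem integral_rpow_mul_exp_le (hα : 0 < α) {κ t : ℝ} (hκ : 0 < κ) (ht : 0 < t) :
    ∫ s in (0 : ℝ)..t, (t - s) ^ (α - 1) * Real.exp (-(κ * (t - s))) ≤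
      (1 / κ) ^ α * Real.Gamma α := by
  rw [intervalIntegral.integral_comp_sub_left
    (fun s => s ^ (α - 1) * Real.exp (-(κ * s))) t, sub_self, sub_zero,
    intervalIntegral.integral_of_le ht.le, ← Real.integral_rpow_mul_exp_neg_mul_Ioi hα hκ]
  refine setIntegral_mono_set ?_ ?_ (Eventually.of_forall Ioc_subset_Ioi_self)
  · refine Integrable.of_integral_ne_zero ?_
    rw [Real.integral_rpow_mul_exp_neg_mul_Ioi hα hκ]
    have := Real.Gamma_pos_of_pos hα
    positivity
  · filter_upwards [self_mem_ae_restrict measurableSet_Ioi] with s hs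
    have : (0 : ℝ) < s := hs
    simp only [Pi.zero_apply]
    positivity

/-- The homogeneous Abel-Volterra equation has only the zero solution. -/
theorem eq_zero_of_volterra (hα : 0 < α) {z : ℝ → ℝ} {c : ℝ}
    (hc : ContinuousOn z (Ici 0)) (h0 : z 0 = 0)
    (hz : ∀ t, 0 < t → z t = c * ∫ s in (0 : ℝ)..t, (t - s) ^ (α - 1) * z s)
    {T : ℝ} (hT : 0 ≤ T) : z T = 0 := by
  have hG := Real.Gamma_pos_of_pos hα
  -- In the supremum norm weighted by `exp (-κ s)` the Volterra operator has norm at most `1/2` for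
  -- this `κ`; hence `M ≤ M / 2` below.
  obtain ⟨κ, hκ, hκc⟩ : ∃ κ : ℝ, 0 < κ ∧ |c| * ((1 / κ) ^ α * Real.Gamma α) ≤ 1 / 2 := by
    have h := (tendsto_rpow_atTop hα).eventually_ge_atTop (2 * (|c| * Real.Gamma α))
    obtain ⟨κ, h1, h2⟩ := ((eventually_gt_atTop 0).and h).exists
    refine ⟨κ, h1, ?_⟩
    have hκα : 0 < κ ^ α := Real.rpow_pos_of_pos h1 _
    rw [one_div, Real.inv_rpow h1.le]
    rw [show |c| * ((κ ^ α)⁻¹ * Real.Gamma α) = (|c| * Real.Gamma α) / κ ^ α by ring,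
      div_le_iff₀ hκα]
    linarith
  obtain ⟨t, htI, htmax⟩ := isCompact_Icc.exists_isMaxOn (s := Icc 0 T)
    (f := fun s => Real.exp (-(κ * s)) * |z s|) ⟨0, le_rfl, hT⟩
    ((Continuous.continuousOn (by fun_prop)).mul (hc.mono Icc_subset_Ici_self).abs)
  set M := Real.exp (-(κ * t)) * |z t| with hM
  have hM0 : 0 ≤ M := by positivity
  have hle : ∀ s ∈ Icc 0 T, |z s| ≤ M * Real.exp (κ * s) := fun s hs => by
    have h : Real.exp (-(κ * s)) * |z s| ≤ M := htmax hs
    have := mul_le_mul_of_nonneg_right h (Real.exp_pos (κ * s)).le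
    rwa [mul_right_comm, ← Real.exp_add, neg_add_cancel, Real.exp_zero, one_mul] at this
  suffices hMz : M ≤ 0 by
    have := hle T ⟨hT, le_rfl⟩
    have hM' : M = 0 := le_antisymm hMz hM0
    rw [hM', zero_mul] at this
    exact abs_nonpos_iff.1 this
  clear_value M
  rcases htI.1.eq_or_lt with ht | ht
  · rw [hM, ← ht, h0]; simp
  have hexp : ∀ s, M * Real.exp (κ * s) = M * Real.exp (κ * t) * Real.exp (-(κ * (t - s))) :=
    fun s => by rw [mul_assoc M, ← Real.exp_add]; ring_nf
  have hI : |∫ s in (0 : ℝ)..t, (t - s) ^ (α - 1) * z s| ≤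
      M * Real.exp (κ * t) * ((1 / κ) ^ α * Real.Gamma α) := by
    have hiI : IntervalIntegrable (fun s => M * Real.exp (κ * t) *
        ((t - s) ^ (α - 1) * Real.exp (-(κ * (t - s))))) volume 0 t :=
      ((intervalIntegrable_sub_rpow hα).mul_continuousOn
        (Continuous.continuousOn (by fun_prop))).const_mul _
    calc |∫ s in (0 : ℝ)..t, (t - s) ^ (α - 1) * z s|
        ≤ ∫ s in (0 : ℝ)..t, M * Real.exp (κ * t) *
          ((t - s) ^ (α - 1) * Real.exp (-(κ * (t - s)))) := by
          rw [← Real.norm_eq_abs]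
          refine intervalIntegral.norm_integral_le_of_norm_le ht.le
            (Eventually.of_forall fun s hs => ?_) hiI
          have h1 : 0 ≤ (t - s) ^ (α - 1) := Real.rpow_nonneg (by linarith [hs.2]) _
          rw [norm_mul, Real.norm_of_nonneg h1, Real.norm_eq_abs]
          have h2 := hle s ⟨hs.1.le, hs.2.trans htI.2⟩
          rw [hexp] at h2
          calc _ ≤ (t - s) ^ (α - 1) * (M * Real.exp (κ * t) * Real.exp (-(κ * (t - s)))) :=
                mul_le_mul_of_nonneg_left h2 h1
            _ = _ := by ring
      _ = M * Real.exp (κ * t) *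
          ∫ s in (0 : ℝ)..t, (t - s) ^ (α - 1) * Real.exp (-(κ * (t - s))) :=
          intervalIntegral.integral_const_mul _ _
      _ ≤ _ := mul_le_mul_of_nonneg_left (integral_rpow_mul_exp_le hα hκ ht) (by positivity)
  have hzt : |z t| ≤ M * Real.exp (κ * t) * (1 / 2) := by
    rw [hz t ht, abs_mul]
    calc _ ≤ |c| * (M * Real.exp (κ * t) * ((1 / κ) ^ α * Real.Gamma α)) :=
          mul_le_mul_of_nonneg_left hI (abs_nonneg _)
      _ = M * Real.exp (κ * t) * (|c| * ((1 / κ) ^ α * Real.Gamma α)) := by ring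
      _ ≤ _ := mul_le_mul_of_nonneg_left hκc (by positivity)
  have hfin : M ≤ M * (1 / 2) := by
    calc M = Real.exp (-(κ * t)) * |z t| := hM
      _ ≤ Real.exp (-(κ * t)) * (M * Real.exp (κ * t) * (1 / 2)) :=
          mul_le_mul_of_nonneg_left hzt (Real.exp_pos _).le
      _ = (Real.exp (-(κ * t)) * Real.exp (κ * t)) * (M * (1 / 2)) := by ring
      _ = _ := by rw [← Real.exp_add, neg_add_cancel, Real.exp_zero, one_mul]
  linarith

/-- Every sine coefficient of a weak solution solves a scalar Volterra equation. -/
theorem IsWeakSolution.inner_eq (hα : 0 < α) (hα1 : α < 1) {f : L2Rod} {v : ℝ → L2Rod}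
    (hv : IsWeakSolution α f v) (n : ℕ) {t : ℝ} (ht : 0 < t) :
    inner ℝ (v t) (sineBasis n) = inner ℝ f (sineBasis n) + -(freq n ^ 2) / Real.Gamma α *
      ∫ s in (0 : ℝ)..t, (t - s) ^ (α - 1) * inner ℝ (v s) (sineBasis n) := by
  have hs : ∀ x : ℝ, HasDerivAt (fun x : ℝ => Real.sqrt (2 / Real.pi) * Real.sin ((n + 1 : ℝ) * x))
      (Real.sqrt (2 / Real.pi) * (Real.cos ((n + 1 : ℝ) * x) * (n + 1 : ℝ))) x := fun x => by
    have := ((Real.hasDerivAt_sin ((n + 1 : ℝ) * x)).comp x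
      ((hasDerivAt_id x).const_mul (n + 1 : ℝ))).const_mul (Real.sqrt (2 / Real.pi))
    simpa using this
  have hc : ∀ x : ℝ, HasDerivAt
      (fun x : ℝ => Real.sqrt (2 / Real.pi) * (Real.cos ((n + 1 : ℝ) * x) * (n + 1 : ℝ)))
      (-(freq n ^ 2) * (Real.sqrt (2 / Real.pi) * Real.sin ((n + 1 : ℝ) * x))) x := fun x => by
    have := (((Real.hasDerivAt_cos ((n + 1 : ℝ) * x)).comp x
      ((hasDerivAt_id x).const_mul (n + 1 : ℝ))).mul_const (n + 1 : ℝ)).const_mul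
        (Real.sqrt (2 / Real.pi))
    refine this.congr_deriv ?_
    rw [freq]
    ring
  have hd2 : deriv (deriv fun x : ℝ => Real.sqrt (2 / Real.pi) * Real.sin ((n + 1 : ℝ) * x)) =
      fun x => -(freq n ^ 2) * (Real.sqrt (2 / Real.pi) * Real.sin ((n + 1 : ℝ) * x)) := by
    rw [funext fun x => (hs x).deriv]
    exact funext fun x => (hc x).deriv
  have hsin : Real.sin ((n + 1 : ℝ) * Real.pi) = 0 := by
    have := Real.sin_nat_mul_pi (n + 1)
    push_cast at this
    exact this
  -- The normalized sine is itself an admissible test function, and its second derivative is `-λ²`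
  -- times itself.
  have h := hv.equation _ (show ContDiff ℝ 2 fun x : ℝ =>
    Real.sqrt (2 / Real.pi) * Real.sin ((n + 1 : ℝ) * x) by fun_prop) (by simp)
    (by rw [hsin, mul_zero])
  have e : ∀ s, ∫ x, v s x * (Real.sqrt (2 / Real.pi) * Real.sin ((n + 1 : ℝ) * x)) ∂rodMeasure =
      inner ℝ (v s) (sineBasis n) := fun s => (inner_toLp (v s) (memLp_sine n)).symm
  have e2 : ∀ s, ∫ x, v s x * (-(freq n ^ 2) *
      (Real.sqrt (2 / Real.pi) * Real.sin ((n + 1 : ℝ) * x))) ∂rodMeasure =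
      -(freq n ^ 2) * inner ℝ (v s) (sineBasis n) := fun s => by
    rw [← e, ← integral_const_mul]
    refine integral_congr_ae (Eventually.of_forall fun x => ?_)
    simp only
    ring
  simp only [hd2, e, e2] at h
  have hcont : ContinuousOn (fun s => inner ℝ (v s) (sineBasis n)) (Ici 0) :=
    hv.continuousOn.inner continuousOn_const
  have hV := eq_add_fracIntegral_of_hasCaputoDerivOn hα hα1 hcont h ht
  rw [hV, hv.initial]
  simp_rw [mul_left_comm _ (-(freq n ^ 2))]
  rw [intervalIntegral.integral_const_mul]
  ring

theorem IsWeakSolution.unique (hα : 0 < α) (hα1 : α < 1) {f : L2Rod} {v w : ℝ → L2Rod}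
    (hv : IsWeakSolution α f v) (hw : IsWeakSolution α f w) {t : ℝ} (ht : 0 ≤ t) : v t = w t := by
  refine ext_inner_sine fun n => sub_eq_zero.1 ?_
  have hcv : ContinuousOn (fun s => inner ℝ (v s) (sineBasis n)) (Ici 0) :=
    hv.continuousOn.inner continuousOn_const
  have hcw : ContinuousOn (fun s => inner ℝ (w s) (sineBasis n)) (Ici 0) :=
    hw.continuousOn.inner continuousOn_const
  refine eq_zero_of_volterra hα (c := -(freq n ^ 2) / Real.Gamma α)
    (z := fun s => inner ℝ (v s) (sineBasis n) - inner ℝ (w s) (sineBasis n)) (hcv.sub hcw)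
    (by rw [hv.initial, hw.initial, sub_self]) (fun s hs => ?_) ht
  have hi : ∀ {q : ℝ → ℝ}, ContinuousOn q (Ici 0) →
      IntervalIntegrable (fun r => (s - r) ^ (α - 1) * q r) volume 0 s := fun hq =>
    (intervalIntegrable_sub_rpow hα).mul_continuousOn
      (hq.mono (by rw [uIcc_of_le hs.le]; exact Icc_subset_Ici_self))
  simp_rw [mul_sub]
  rw [intervalIntegral.integral_sub (hi hcv) (hi hcw), hv.inner_eq hα hα1 n hs,
    hw.inner_eq hα hα1 n hs]
  ring

end Volterra

end FracHeat

end

/-! ### Assembly of the theorem. -/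

theorem theorem6p2 :
    -- the constants exist: `C` absolute, `C₂` depending only on a compact range of orders
    (∃ C : ℝ, 0 < C ∧ ∀ α ∈ Set.Ioo (0 : ℝ) 1, FracHeat.IsGenConst α C) ∧
    (∀ α₀ α₁ : ℝ, 0 < α₀ → α₀ < α₁ → α₁ < 1 →
      ∃ C₂ : ℝ, 0 < C₂ ∧ ∀ α ∈ Set.Icc α₀ α₁, FracHeat.IsUpperConst α C₂) ∧
    -- the series is the unique solution of the initial-boundary value problem
    (∀ α ∈ Set.Ioo (0 : ℝ) 1, ∀ f₀ : FracHeat.L2Rod,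
      FracHeat.IsWeakSolution α f₀ (FracHeat.fracHeatSol α f₀) ∧
      ∀ v : ℝ → FracHeat.L2Rod, FracHeat.IsWeakSolution α f₀ v →
        ∀ t : ℝ, 0 ≤ t → v t = FracHeat.fracHeatSol α f₀ t) ∧
    -- the estimate, for all admissible constants
    (∀ (α τ ρ C C₂ : ℝ), 0 < α → α < 1 → 0 < τ → 0 ≤ ρ → 0 < C → 0 < C₂ →
      FracHeat.IsGenConst α C → FracHeat.IsUpperConst α C₂ →
      ∀ f₀ ∈ FracHeat.sourceSet α τ ρ,
        (∀ t : ℝ, 0 ≤ t →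
          ‖FracHeat.fracHeatSol α f₀ t - f₀‖ ≤
            ρ * (C * C₂ / Real.Gamma (1 - α)) * (t ^ α / τ ^ α)) ∧
        FracHeat.SatisfiesSourceAssumption (FracHeat.fracHeatSol α f₀) f₀ (fun t => t ^ α)) := by
  refine ⟨FracHeat.exists_isGenConst, fun α₀ α₁ h0 _ h1 => FracHeat.exists_isUpperConst h0 h1,
    fun α hα f₀ => ⟨FracHeat.isWeakSolution_fracHeatSol hα.1 hα.2 f₀, fun v hv t ht =>
      hv.unique hα.1 hα.2 (FracHeat.isWeakSolution_fracHeatSol hα.1 hα.2 f₀) ht⟩, ?_⟩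
  intro α τ ρ C C₂ hα hα1 hτ hρ hC hC₂ hgen hup f₀ hf₀
  have hest : ∀ t : ℝ, 0 ≤ t → ‖FracHeat.fracHeatSol α f₀ t - f₀‖ ≤
      ρ * (C * C₂ / Real.Gamma (1 - α)) * (t ^ α / τ ^ α) := fun t ht =>
    FracHeat.norm_fracHeatSol_sub_le hα hα1 hτ hC hC₂ hgen hup hf₀ ht
  have hG1 : 0 < Real.Gamma (1 - α) := Real.Gamma_pos_of_pos (by linarith)
  refine ⟨hest, FracHeat.isIndexFunction_rpow hα,
    -- Adding 1 keeps `c₀` strictly positive when `ρ = 0`.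
    ρ * (C * C₂ / Real.Gamma (1 - α)) / τ ^ α + 1, by positivity, fun t ht => ?_⟩
  have htα : 0 < t ^ α := Real.rpow_pos_of_pos ht _
  calc _ ≤ ρ * (C * C₂ / Real.Gamma (1 - α)) * (t ^ α / τ ^ α) := hest t ht.le
    _ = ρ * (C * C₂ / Real.Gamma (1 - α)) / τ ^ α * t ^ α := by ring
    _ ≤ (ρ * (C * C₂ / Real.Gamma (1 - α)) / τ ^ α + 1) * t ^ α := by gcongr; linarith
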